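/- All graphs are finite and simple. The $Q$-index $q_1(G)$ of a graph $G$ is the largest eigenvalue of its signless Laplacian $Q(G)=D(G)+A(G)$, where $D(G)$ is the diagonal matrix of vertex degrees and $A(G)$ is the adjacency matrix. A graph $H$ is a minor of $G$ if $H$ can be obtained from a subgraph of $G$ by contracting edges; $G$ is $H$-minor free if $H$ is not a minor of $G$. For $k\ge 0$, $S^{k}(K_t)$ denotes the graph obtained from the complete graph $K_t$ by subdividing one edge $k$ times, i.e. by replacing one edge by a path with the same ends and $k$ new inner vertices. **Theorem 1.1.** Let $t\ge 3$ and $n\ge t+1$. Among all connected $K_{1,t}$-minor free graphs on $n$ vertices there is, up to isomorphism, exactly one graph $G^*$ with the maximum $Q$-index, namely: 1. if $n=t+1$ is even, $G^*$ is $K_n$ with $n/2$ pairwise disjoint edges removed (a perfect matching); 2. if $n=t+1$ is odd, $G^*$ is $K_n$ with $\lfloor n/2\rfloor$ pairwise disjoint edges removed together with one further edge at the vertex that these edges miss (so the removed edges form a path with two edges and $(n-3)/2$ single edges, all disjoint); 3. if $n\ge t+2$, $G^*\cong S^{n-t}(K_t)$. -/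

import Mathlib

namespace QIndexMinor

open SimpleGraph

/-- `H` is obtained from `G` by contracting edges: the vertices of `H` are the classes of a
partition of the vertices of `G` into connected parts (each part is contracted to one vertex), and
two distinct classes are adjacent iff some edge of `G` joins them. -/
def IsContraction {W V : Type*} (H : SimpleGraph W) (G : SimpleGraph V) : Prop :=
  ∃ f : V → W, Function.Surjective f ∧
    (∀ w : W, (G.induce {v | f v = w}).Connected) ∧
    ∀ a b : W, H.Adj a b ↔ a ≠ b ∧ ∃ x y : V, f x = a ∧ f y = b ∧ G.Adj x y

/-- `H` is a minor of `G`: it is obtained from a subgraph of `G` by contracting edges. -/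
def IsMinor {W V : Type*} (H : SimpleGraph W) (G : SimpleGraph V) : Prop :=
  ∃ G' : G.Subgraph, IsContraction H G'.coe

/-- `G` has no `K_{1,t}` minor. -/
def StarMinorFree {V : Type*} (t : ℕ) (G : SimpleGraph V) : Prop :=
  ¬ IsMinor (completeBipartiteGraph (Fin 1) (Fin t)) G

open Classical in
/-- The signless Laplacian `Q(G) = D(G) + A(G)`. -/
noncomputable def signlessLaplacian {V : Type*} [Fintype V] (G : SimpleGraph V) :
    Matrix V V ℝ :=
  G.degMatrix ℝ + G.adjMatrix ℝ

open Classical in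
/-- The `Q`-index of `G`: the largest eigenvalue of the signless Laplacian (for a graph with at
least one vertex the supremum is a maximum, see `isGreatest_qIndex`). -/
noncomputable def qIndex {V : Type*} [Fintype V] (G : SimpleGraph V) : ℝ :=
  sSup (spectrum ℝ (signlessLaplacian G))

open Classical in
theorem isGreatest_qIndex {V : Type*} [Fintype V] [Nonempty V] (G : SimpleGraph V) :
    IsGreatest (spectrum ℝ (signlessLaplacian G)) (qIndex G) := by
  have hA : (signlessLaplacian G).IsHermitian := by
    unfold signlessLaplacian
    refine Matrix.IsHermitian.add ?_ ?_
    · exact Matrix.isHermitian_diagonal _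
    · rw [Matrix.IsHermitian, Matrix.conjTranspose_eq_transpose_of_trivial]
      exact G.transpose_adjMatrix
  have hfin : (spectrum ℝ (signlessLaplacian G)).Finite := Matrix.finite_real_spectrum
  have hne : (spectrum ℝ (signlessLaplacian G)).Nonempty :=
    ⟨_, Matrix.IsHermitian.eigenvalues_mem_spectrum_real hA (Classical.arbitrary V)⟩
  exact ⟨hne.csSup_mem hfin, fun x hx => le_csSup hfin.bddAbove hx⟩

/-- `G` has the maximum `Q`-index among all connected `K_{1,t}`-minor free graphs on `n`
vertices. -/
def IsExtremal (t : ℕ) {n : ℕ} (G : SimpleGraph (Fin n)) : Prop :=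
  G.Connected ∧ StarMinorFree t G ∧
    ∀ G' : SimpleGraph (Fin n), G'.Connected → StarMinorFree t G' → qIndex G' ≤ qIndex G

/-- The `⌊n/2⌋` pairwise disjoint pairs `{0,1}, {2,3}, …` of `Fin n`. -/
def pairing (n : ℕ) : Set (Sym2 (Fin n)) :=
  {e | ∃ i j : Fin n, Even i.val ∧ j.val = i.val + 1 ∧ e = s(i, j)}

/-- Subdividing the edge `ab` of `G` `k` times: the edge `ab` is replaced by a path
`a, 0, 1, …, k - 1, b` through `k` new vertices (nothing changes if `k = 0`). -/
def subdivideEdge {V : Type*} (G : SimpleGraph V) (a b : V) (k : ℕ) :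
    SimpleGraph (V ⊕ Fin k) where
  Adj
    | .inl x, .inl y => G.Adj x y ∧ (k = 0 ∨ s(x, y) ≠ s(a, b))
    | .inl x, .inr i => (x = a ∧ i.val = 0) ∨ (x = b ∧ i.val + 1 = k)
    | .inr i, .inl x => (x = a ∧ i.val = 0) ∨ (x = b ∧ i.val + 1 = k)
    | .inr i, .inr j => i.val + 1 = j.val ∨ j.val + 1 = i.val
  symm := ⟨by
    rintro (x | i) (y | j) h
    · exact ⟨h.1.symm, by rw [Sym2.eq_swap]; exact h.2⟩
    · exact h
    · exact h
    · exact h.symm⟩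
  loopless := ⟨by
    rintro (x | i) h
    · exact G.irrefl h.1
    · rcases h with h | h <;> omega⟩

end QIndexMinor

/-!
The `Q`-index `q` of a connected graph has a positive eigenvector `x` (`exists_isPerronVector`), and
it strictly increases when edges are added (`eq_of_le_of_qIndex_le`). A connected set of vertices is
contracted to the centre of a star, so `K_{1,t}`-minor freeness says that every connected set has
fewer than `t` outside neighbours (`starMinorFree_iff`). In particular all degrees are at most
`t - 1`, so `q ≤ 2 (t - 1)`; write `q = 2 (t - 1) - δ`. By `isExtremal_iff` it suffices to show that
a competitor whose `Q`-index is at least that of the candidate is isomorphic to the candidate.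

The local principle is `exists_degree_eq_of_qIndex_eq`: if `(t + 1) δ - δ² < 2`, then the vertex
where `x` is largest and all of its neighbours have degree `t - 1`, since the entries at the
neighbours are within a fraction `δ` of the maximum and a smaller degree would push an entry below
that.

* If `n = t + 1` is even, the candidate is `(n - 2)`-regular and attains `q = 2 (n - 2)`; equality
  forces regularity, and the complement is a perfect matching.
* If `n = t + 1` is odd, the local principle leaves only graphs in which all vertices but one have
  exactly one non-neighbour, and the last vertex `w` has `a` of them, with `a` even and
  `2 ≤ a ≤ n - 3` by parity and connectedness. For these graphs `q` is a root of an explicit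
  equation (`qIndex_equation`), and comparing the roots gives `a = 2`
  (`false_of_star_equations`).
* If `n ≥ t + 2`, the closed neighbourhood found by the local principle has to be a complete graph
  `K_t` without one edge `ab`, whose ends have distinct outside neighbours `a'` and `b'`
  (`exists_isCore`). Contracting `a` together with balls around `a'` shows that the vertices outside
  form a path from `a'` to `b'`, or two paths starting there. In either case the graph is a spanning
  subgraph of the subdivided complete graph (`IsCore.exists_equiv`), and strict monotonicity of
  the `Q`-index gives equality.
-/

namespace QIndexMinor

open SimpleGraph Finset Matrix

/-! ### Perron vectors and monotonicity of the `Q`-index -/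

section Spectral

open Classical

variable {V : Type*} [Fintype V]

theorem signlessLaplacian_mulVec_apply (G : SimpleGraph V) (x : V → ℝ) (v : V) :
    (signlessLaplacian G *ᵥ x) v = ∑ u ∈ G.neighborFinset v, (x v + x u) := by
  rw [signlessLaplacian, Matrix.add_mulVec, Pi.add_apply, degMatrix_mulVec_apply,
    adjMatrix_mulVec_apply, Finset.sum_add_distrib, Finset.sum_const, card_neighborFinset_eq_degree,
    nsmul_eq_mul]

theorem signlessLaplacian_isHermitian (G : SimpleGraph V) :
    (signlessLaplacian G).IsHermitian := by
  refine (Matrix.isHermitian_diagonal _).add ?_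
  rw [Matrix.IsHermitian, Matrix.conjTranspose_eq_transpose_of_trivial]
  exact G.transpose_adjMatrix

/-- Each edge `uv` contributes `(x u + x v) ^ 2` twice, once for each orientation. -/
theorem two_mul_quadraticForm (G : SimpleGraph V) (x : V → ℝ) :
    2 * (x ⬝ᵥ signlessLaplacian G *ᵥ x) =
      ∑ u, ∑ v, if G.Adj u v then (x u + x v) ^ 2 else 0 := by
  have h1 : x ⬝ᵥ signlessLaplacian G *ᵥ x =
      ∑ u, ∑ v, if G.Adj u v then x u * (x u + x v) else 0 := by
    refine Finset.sum_congr rfl fun u _ => ?_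
    rw [signlessLaplacian_mulVec_apply, Finset.mul_sum, neighborFinset_eq_filter,
      Finset.sum_filter]
  have h2 : x ⬝ᵥ signlessLaplacian G *ᵥ x =
      ∑ u, ∑ v, if G.Adj u v then x v * (x u + x v) else 0 := by
    rw [h1, Finset.sum_comm]
    refine Finset.sum_congr rfl fun u _ => Finset.sum_congr rfl fun v _ => ?_
    rw [G.adj_comm, add_comm]
  rw [two_mul]
  nth_rewrite 1 [h1]
  rw [h2, ← Finset.sum_add_distrib]
  refine Finset.sum_congr rfl fun u _ => ?_
  rw [← Finset.sum_add_distrib]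
  refine Finset.sum_congr rfl fun v _ => ?_
  split_ifs <;> ring

theorem posSemidef_qIndex_sub (G : SimpleGraph V) [Nonempty V] :
    (algebraMap ℝ (Matrix V V ℝ) (qIndex G) - signlessLaplacian G).PosSemidef := by
  rw [Matrix.posSemidef_iff_isHermitian_and_spectrum_nonneg]
  constructor
  · refine Matrix.IsHermitian.sub ?_ (signlessLaplacian_isHermitian G)
    rw [Matrix.algebraMap_eq_diagonal]
    exact Matrix.isHermitian_diagonal _
  · intro r hr
    rw [← spectrum.singleton_sub_eq] at hr
    obtain ⟨a, ha, b, hb, rfl⟩ := Set.mem_sub.1 hr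
    rw [Set.mem_singleton_iff.1 ha]
    exact sub_nonneg.2 ((isGreatest_qIndex G).2 hb)

theorem dotProduct_qIndex_sub (G : SimpleGraph V) (x : V → ℝ) :
    x ⬝ᵥ ((algebraMap ℝ (Matrix V V ℝ) (qIndex G) - signlessLaplacian G) *ᵥ x) =
      qIndex G * ∑ v, x v ^ 2 - x ⬝ᵥ signlessLaplacian G *ᵥ x := by
  rw [Matrix.sub_mulVec, dotProduct_sub, Algebra.algebraMap_eq_smul_one, Matrix.smul_mulVec,
    Matrix.one_mulVec, dotProduct_smul, smul_eq_mul]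
  simp only [dotProduct, sq]

/-- The Rayleigh bound for the `Q`-index. -/
theorem quadraticForm_le (G : SimpleGraph V) [Nonempty V] (x : V → ℝ) :
    x ⬝ᵥ signlessLaplacian G *ᵥ x ≤ qIndex G * ∑ v, x v ^ 2 := by
  have h := (posSemidef_qIndex_sub G).dotProduct_mulVec_nonneg x
  rw [star_trivial, dotProduct_qIndex_sub] at h
  linarith

/-- A vector attaining the Rayleigh bound is an eigenvector. -/
theorem eigenvector_of_quadraticForm_ge (G : SimpleGraph V) [Nonempty V] {x : V → ℝ}
    (hx : qIndex G * ∑ v, x v ^ 2 ≤ x ⬝ᵥ signlessLaplacian G *ᵥ x) (v : V) :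
    qIndex G * x v = ∑ u ∈ G.neighborFinset v, (x v + x u) := by
  have h := (posSemidef_qIndex_sub G).dotProduct_mulVec_zero_iff x
  rw [star_trivial, dotProduct_qIndex_sub] at h
  have h0 := congrFun (h.1 (by linarith [quadraticForm_le G x])) v
  rw [Matrix.sub_mulVec, Algebra.algebraMap_eq_smul_one, Matrix.smul_mulVec,
    Matrix.one_mulVec, Pi.sub_apply, signlessLaplacian_mulVec_apply] at h0
  simpa [sub_eq_zero] using h0

theorem exists_eigenvector (G : SimpleGraph V) [Nonempty V] :
    ∃ x : V → ℝ, x ≠ 0 ∧ signlessLaplacian G *ᵥ x = qIndex G • x := by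
  have h := (isGreatest_qIndex G).1
  rw [← Matrix.spectrum_toLin', ← Module.End.hasEigenvalue_iff_mem_spectrum] at h
  obtain ⟨x, hx⟩ := h.exists_hasEigenvector
  exact ⟨x, hx.2, by simpa using hx.apply_eq_smul⟩

/-- A vector of real numbers that is positive and an eigenvector of `Q(G)` for the `Q`-index. -/
structure IsPerronVector (G : SimpleGraph V) (x : V → ℝ) : Prop where
  pos : ∀ v, 0 < x v
  eq : ∀ v, qIndex G * x v = ∑ u ∈ G.neighborFinset v, (x v + x u)

/-- The Perron–Frobenius theorem for the signless Laplacian: the absolute value of an eigenvector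
again attains the Rayleigh bound, and its zero set is closed under adjacency. -/
theorem exists_isPerronVector {G : SimpleGraph V} (hG : G.Connected) :
    ∃ x, IsPerronVector G x := by
  have := hG.nonempty
  obtain ⟨y, hy0, hy⟩ := exists_eigenvector G
  have hyy : 2 * (qIndex G * ∑ v, y v ^ 2) = 2 * (y ⬝ᵥ signlessLaplacian G *ᵥ y) := by
    rw [hy, dotProduct_smul, smul_eq_mul]
    simp only [dotProduct, sq]
  have hge : qIndex G * ∑ v, |y v| ^ 2 ≤
      (fun v => |y v|) ⬝ᵥ signlessLaplacian G *ᵥ (fun v => |y v|) := by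
    refine le_of_mul_le_mul_left ?_ (zero_lt_two (α := ℝ))
    simp only [sq_abs]
    rw [hyy, two_mul_quadraticForm, two_mul_quadraticForm]
    refine Finset.sum_le_sum fun u _ => Finset.sum_le_sum fun v _ => ?_
    split_ifs
    · exact sq_le_sq' (by linarith [neg_abs_le (y u), neg_abs_le (y v)])
        (by linarith [le_abs_self (y u), le_abs_self (y v)])
    · exact le_rfl
  have heq := eigenvector_of_quadraticForm_ge G hge
  have hstep : ∀ u v, G.Adj u v → y u = 0 → y v = 0 := by
    intro u v huv hu
    have h := heq u
    simp only [hu, abs_zero, mul_zero, zero_add] at h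
    have := (Finset.sum_eq_zero_iff_of_nonneg (fun w _ => abs_nonneg (y w))).1 h.symm v
      (by simpa using huv)
    simpa using this
  refine ⟨fun v => |y v|, fun v => ?_, heq⟩
  rw [abs_pos]
  intro hv
  apply hy0
  funext w
  obtain ⟨p⟩ := hG.preconnected v w
  induction p with
  | nil => exact hv
  | cons h p ih => exact ih (hstep _ _ h hv)

theorem IsPerronVector.quadraticForm_eq {G : SimpleGraph V} {x : V → ℝ} (hx : IsPerronVector G x) :
    x ⬝ᵥ signlessLaplacian G *ᵥ x = qIndex G * ∑ v, x v ^ 2 := by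
  rw [Finset.mul_sum]
  refine Finset.sum_congr rfl fun v _ => ?_
  rw [signlessLaplacian_mulVec_apply, ← hx.eq]
  ring

theorem IsPerronVector.sum_neighbors {G : SimpleGraph V} {x : V → ℝ} (hx : IsPerronVector G x)
    (v : V) : qIndex G * x v = G.degree v * x v + ∑ u ∈ G.neighborFinset v, x u := by
  rw [hx.eq, Finset.sum_add_distrib, Finset.sum_const, card_neighborFinset_eq_degree, nsmul_eq_mul]

/-- The column sums of `Q(G)` are twice the degrees. -/
theorem IsPerronVector.sum_eq {G : SimpleGraph V} {x : V → ℝ} (hx : IsPerronVector G x) :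
    qIndex G * ∑ v, x v = ∑ v, 2 * G.degree v * x v := by
  have h : ∑ v, ∑ u ∈ G.neighborFinset v, x u = ∑ v, G.degree v * x v := by
    simp only [neighborFinset_eq_filter, Finset.sum_filter]
    rw [Finset.sum_comm]
    refine Finset.sum_congr rfl fun v _ => ?_
    rw [← Finset.sum_filter, Finset.sum_const, nsmul_eq_mul, ← card_neighborFinset_eq_degree,
      neighborFinset_eq_filter]
    simp only [G.adj_comm]
  rw [Finset.mul_sum, Finset.sum_congr rfl fun v _ => hx.sum_neighbors v, Finset.sum_add_distrib, h,
    ← Finset.sum_add_distrib]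
  exact Finset.sum_congr rfl fun v _ => by ring

/-- Adding edges to a connected graph strictly increases its `Q`-index. -/
theorem eq_of_le_of_qIndex_le {G H : SimpleGraph V} (hG : G.Connected) (hle : G ≤ H)
    (hq : qIndex H ≤ qIndex G) : G = H := by
  have := hG.nonempty
  obtain ⟨x, hx⟩ := exists_isPerronVector hG
  by_contra hne
  obtain ⟨u, v, huv, hnuv⟩ : ∃ u v, H.Adj u v ∧ ¬ G.Adj u v := by
    by_contra! hcon
    exact hne (le_antisymm hle fun u v h => hcon u v h)
  have hlt : 2 * (x ⬝ᵥ signlessLaplacian G *ᵥ x) < 2 * (x ⬝ᵥ signlessLaplacian H *ᵥ x) := by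
    rw [two_mul_quadraticForm, two_mul_quadraticForm]
    have hterm : ∀ a b, (if G.Adj a b then (x a + x b) ^ 2 else 0) ≤
        if H.Adj a b then (x a + x b) ^ 2 else 0 := by
      intro a b
      by_cases h : G.Adj a b
      · rw [if_pos h, if_pos (hle h)]
      · rw [if_neg h]
        split_ifs <;> positivity
    refine Finset.sum_lt_sum (fun a _ => Finset.sum_le_sum fun b _ => hterm a b)
      ⟨u, Finset.mem_univ _, Finset.sum_lt_sum (fun b _ => hterm u b) ⟨v, Finset.mem_univ _, ?_⟩⟩
    rw [if_neg hnuv, if_pos huv]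
    have := hx.pos u
    have := hx.pos v
    positivity
  have h1 := quadraticForm_le H x
  rw [hx.quadraticForm_eq] at hlt
  have h2 : qIndex H * ∑ v, x v ^ 2 ≤ qIndex G * ∑ v, x v ^ 2 :=
    mul_le_mul_of_nonneg_right hq (Finset.sum_nonneg fun v _ => sq_nonneg _)
  linarith

theorem qIndex_iso {W : Type*} [Fintype W] {G : SimpleGraph V} {H : SimpleGraph W} (e : G ≃g H) :
    qIndex G = qIndex H := by
  have h : signlessLaplacian H = Matrix.reindexAlgEquiv ℝ ℝ e.toEquiv (signlessLaplacian G) := by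
    ext a b
    obtain ⟨a, rfl⟩ := e.surjective a
    obtain ⟨b, rfl⟩ := e.surjective b
    have hd : H.degree (e a) = G.degree a := e.degree_eq a
    have hs : ∀ c, e.toEquiv.symm (e c) = c := e.toEquiv.symm_apply_apply
    have ha : H.Adj (e a) (e b) ↔ G.Adj a b := e.map_adj_iff
    simp [signlessLaplacian, degMatrix, Matrix.diagonal_apply, adjMatrix_apply, hd, hs, ha]
  rw [qIndex, qIndex, h, AlgEquiv.spectrum_eq]

/-- A bijective homomorphism from a connected graph to a graph with no larger `Q`-index is an
isomorphism. -/
theorem nonempty_iso_of_qIndex_le {W : Type*} [Fintype W] {G : SimpleGraph V} {H : SimpleGraph W}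
    (hG : G.Connected) (φ : V ≃ W) (hφ : ∀ u v, G.Adj u v → H.Adj (φ u) (φ v))
    (hq : qIndex H ≤ qIndex G) : Nonempty (G ≃g H) := by
  have e : H.comap φ ≃g H := ⟨φ, by simp⟩
  have h : G = H.comap φ :=
    eq_of_le_of_qIndex_le hG (fun u v huv => hφ u v huv) (by rwa [qIndex_iso e])
  exact ⟨h ▸ e⟩

end Spectral

/-! ### Star minors as connected sets with many outside neighbours -/

section Minor

variable {V W : Type*} {G : SimpleGraph V}

theorem exists_adj_of_connected (hG : G.Connected) (p : V → Prop) {u w : V} (hu : p u)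
    (hw : ¬ p w) : ∃ x y, p x ∧ ¬ p y ∧ G.Adj x y := by
  obtain ⟨q⟩ := hG.preconnected u w
  induction q with
  | nil => exact absurd hu hw
  | @cons a b c h q ih =>
    by_cases hb : p b
    · exact ih hb hw
    · exact ⟨a, b, hu, hb, h⟩

theorem exists_adj_of_induce_connected {S : Set V} (hS : (G.induce S).Connected) (p : V → Prop)
    {u w : V} (huS : u ∈ S) (hwS : w ∈ S) (hu : p u) (hw : ¬ p w) :
    ∃ x ∈ S, ∃ y ∈ S, p x ∧ ¬ p y ∧ G.Adj x y := by
  obtain ⟨x, y, hx, hy, h⟩ := exists_adj_of_connected hS (fun v => p v.1)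
    (u := ⟨u, huS⟩) (w := ⟨w, hwS⟩) hu hw
  exact ⟨x, x.2, y, y.2, hx, hy, h⟩

/-- A set is connected if each of its elements except `r` has a neighbour of smaller rank in it. -/
theorem induce_connected_of_rank {S : Set V} {r : V} (hr : r ∈ S) (rank : V → ℕ)
    (h : ∀ x ∈ S, x ≠ r → ∃ y ∈ S, G.Adj x y ∧ rank y < rank x) : (G.induce S).Connected := by
  have key : ∀ k, ∀ x, ∀ hx : x ∈ S, rank x = k → (G.induce S).Reachable ⟨x, hx⟩ ⟨r, hr⟩ := by
    intro k
    induction k using Nat.strong_induction_on with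
    | _ k ih =>
      intro x hx hk
      by_cases hxr : x = r
      · subst hxr
        exact Reachable.refl _
      · obtain ⟨y, hy, hxy, hlt⟩ := h x hx hxr
        have hadj : (G.induce S).Adj ⟨x, hx⟩ ⟨y, hy⟩ := hxy
        exact hadj.reachable.trans (ih _ (hk ▸ hlt) y hy rfl)
  have : Nonempty S := ⟨⟨r, hr⟩⟩
  exact ⟨fun x y => (key _ x.1 x.2 rfl).trans (key _ y.1 y.2 rfl).symm⟩

theorem induce_singleton_connected (v : V) : (G.induce {v}).Connected :=
  induce_connected_of_rank (r := v) rfl (fun _ => 0) fun _ hx hxr => absurd hx hxr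

theorem induce_pair_connected {u v : V} (h : G.Adj u v) :
    (G.induce {u, v}).Connected := by
  classical
  refine induce_connected_of_rank (r := u) (by simp) (fun x => if x = u then 0 else 1) ?_
  rintro x (rfl | rfl) hx
  · exact absurd rfl hx
  · exact ⟨u, by simp, h.symm, by simp [hx]⟩

/-- `K_{1,t}` is a minor of `G` iff some connected set has `t` neighbours outside it: the set is
contracted to the centre of the star. -/
theorem isMinor_star_iff {t : ℕ} :
    IsMinor (completeBipartiteGraph (Fin 1) (Fin t)) G ↔
      ∃ S : Set V, (G.induce S).Connected ∧ ∃ g : Fin t → V, Function.Injective g ∧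
        ∀ i, g i ∉ S ∧ ∃ x ∈ S, G.Adj x (g i) := by
  constructor
  · rintro ⟨G', f, hf, hconn, hadj⟩
    have hleaf : ∀ i : Fin t, ∃ x y : G'.verts, f x = .inl 0 ∧ f y = .inr i ∧ G'.coe.Adj x y := by
      intro i
      have h : (completeBipartiteGraph (Fin 1) (Fin t)).Adj (.inl 0) (.inr i) := by
        simp [completeBipartiteGraph]
      exact ((hadj _ _).1 h).2
    choose x y hx hy hxy using hleaf
    let S : Set V := {v | ∃ h : v ∈ G'.verts, f ⟨v, h⟩ = .inl 0}
    refine ⟨S, ?_, fun i => (y i).1, ?_, fun i => ⟨?_, (x i).1, ⟨(x i).2, hx i⟩, ?_⟩⟩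
    · let φ : G'.coe.induce {v | f v = .inl 0} →g G.induce S :=
        ⟨fun v => ⟨v.1.1, v.1.2, v.2⟩, fun h => G'.adj_sub h⟩
      refine (hconn (.inl 0)).map φ ?_
      rintro ⟨v, h, hv⟩
      exact ⟨⟨⟨v, h⟩, hv⟩, rfl⟩
    · intro i j hij
      have hij' : y i = y j := Subtype.ext hij
      have h := hy i
      rw [hij', hy j] at h
      exact (Sum.inr.inj h).symm
    · rintro ⟨h, h0⟩
      exact absurd ((hy i).symm.trans h0) (by simp)
    · exact G'.adj_sub (hxy i)
  · classical
    rintro ⟨S, hS, g, hg, hgS⟩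
    let G' : G.Subgraph :=
      { verts := S ∪ Set.range g
        Adj := fun u v => G.Adj u v ∧ (u ∈ S ∨ v ∈ S) ∧ u ∈ S ∪ Set.range g ∧ v ∈ S ∪ Set.range g
        adj_sub := fun h => h.1
        edge_vert := fun h => h.2.2.1
        symm := ⟨fun u v h => ⟨h.1.symm, h.2.1.symm, h.2.2.2, h.2.2.1⟩⟩ }
    let f : G'.verts → Fin 1 ⊕ Fin t := fun v =>
      if h : ∃ i, g i = v.1 then .inr h.choose else .inl 0
    have hfS : ∀ v : G'.verts, v.1 ∈ S → f v = .inl 0 := by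
      intro v hv
      refine dif_neg ?_
      rintro ⟨i, hi⟩
      exact (hgS i).1 (hi ▸ hv)
    have hfg : ∀ (v : G'.verts) i, v.1 = g i → f v = .inr i := by
      intro v i hv
      have h : ∃ i, g i = v.1 := ⟨i, hv.symm⟩
      have h2 : h.choose = i := hg (h.choose_spec.trans hv)
      exact (dif_pos h).trans (congrArg _ h2)
    have hcase : ∀ v : G'.verts, v.1 ∈ S ∨ ∃ i, v.1 = g i := by
      rintro ⟨v, hv | ⟨i, hi⟩⟩
      · exact Or.inl hv
      · exact Or.inr ⟨i, hi.symm⟩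
    have hf0 : ∀ (v : G'.verts), f v = .inl 0 → v.1 ∈ S := by
      intro v hv
      rcases hcase v with h | ⟨i, hi⟩
      · exact h
      · rw [hfg v i hi] at hv
        exact absurd hv (by simp)
    have hfi : ∀ (v : G'.verts) i, f v = .inr i → v.1 = g i := by
      intro v i hv
      rcases hcase v with h | ⟨j, hj⟩
      · rw [hfS v h] at hv
        exact absurd hv (by simp)
      · rw [hfg v j hj] at hv
        rw [hj, Sum.inr.inj hv]
    have hvS : ∀ v ∈ S, v ∈ G'.verts := fun v hv => Or.inl hv
    have hvg : ∀ i, g i ∈ G'.verts := fun i => Or.inr ⟨i, rfl⟩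
    obtain ⟨s, hs⟩ := hS.nonempty
    refine ⟨G', f, ?_, ?_, ?_⟩
    · rintro (a | i)
      · exact ⟨⟨s, hvS s hs⟩, by rw [hfS _ hs, Subsingleton.elim a 0]⟩
      · exact ⟨⟨g i, hvg i⟩, hfg _ i rfl⟩
    · rintro (a | i)
      · obtain rfl : a = 0 := Subsingleton.elim _ _
        let φ : G.induce S →g G'.coe.induce {v | f v = .inl 0} :=
          ⟨fun v => ⟨⟨v.1, hvS _ v.2⟩, hfS _ v.2⟩, fun {u v} h =>
            ⟨h, Or.inl u.2, Or.inl u.2, Or.inl v.2⟩⟩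
        refine hS.map φ ?_
        rintro ⟨v, hv⟩
        exact ⟨⟨v.1, hf0 v hv⟩, rfl⟩
      · have h1 : {v | f v = .inr i} = {(⟨g i, hvg i⟩ : G'.verts)} := by
          ext v
          exact ⟨fun h => Subtype.ext (hfi v i h), fun h => hfg v i (congrArg Subtype.val h)⟩
        rw [h1]
        exact induce_singleton_connected _
    · have hmain : ∀ i, ∃ x y : G'.verts, f x = .inl 0 ∧ f y = .inr i ∧ G'.coe.Adj x y := by
        intro i
        obtain ⟨-, x, hx, hxi⟩ := hgS i
        exact ⟨⟨x, hvS x hx⟩, ⟨g i, hvg i⟩, hfS _ hx, hfg _ i rfl,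
          hxi, Or.inl hx, hvS x hx, hvg i⟩
      rintro (a | i) (b | j)
      · simp [completeBipartiteGraph, Subsingleton.elim a b]
      · obtain rfl : a = 0 := Subsingleton.elim _ _
        refine iff_of_true (by simp [completeBipartiteGraph]) ⟨by simp, hmain j⟩
      · obtain rfl : b = 0 := Subsingleton.elim _ _
        refine iff_of_true (by simp [completeBipartiteGraph]) ⟨by simp, ?_⟩
        obtain ⟨x, y, hx, hy, h⟩ := hmain i
        exact ⟨y, x, hy, hx, h.symm⟩
      · refine iff_of_false (by simp [completeBipartiteGraph]) ?_
        rintro ⟨-, x, y, hx, hy, -, h | h, -⟩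
        · rw [hfi x i hx] at h
          exact (hgS i).1 h
        · rw [hfi y j hy] at h
          exact (hgS j).1 h

theorem starMinorFree_iff {t : ℕ} :
    StarMinorFree t G ↔ ∀ S : Set V, (G.induce S).Connected → ∀ T : Finset V,
      (∀ y ∈ T, y ∉ S ∧ ∃ x ∈ S, G.Adj x y) → T.card < t := by
  rw [StarMinorFree, isMinor_star_iff]
  constructor
  · intro h S hS T hT
    by_contra! hcard
    obtain ⟨T', hT', hc⟩ := Finset.exists_subset_card_eq hcard
    exact h ⟨S, hS, fun i => (T'.equivFin.symm (Fin.cast hc.symm i)).1,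
      Subtype.val_injective.comp (T'.equivFin.symm.injective.comp (Fin.cast_injective _)),
      fun i => hT _ (hT' (T'.equivFin.symm (Fin.cast hc.symm i)).2)⟩
  · rintro h ⟨S, hS, g, hg, hgS⟩
    have := h S hS (Finset.univ.map ⟨g, hg⟩) (by simpa using hgS)
    simp at this

theorem StarMinorFree.of_iso {t : ℕ} {H : SimpleGraph W} (e : G ≃g H) (hG : StarMinorFree t G) :
    StarMinorFree t H := by
  rw [StarMinorFree, isMinor_star_iff] at hG ⊢
  rintro ⟨S, hS, g, hg, hgS⟩
  refine hG ⟨e ⁻¹' S, ?_, fun i => e.symm (g i), e.symm.injective.comp hg, fun i => ⟨?_, ?_⟩⟩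
  · let φ : H.induce S →g G.induce (e ⁻¹' S) :=
      ⟨fun v => ⟨e.symm v.1, by simp [v.2]⟩, fun h => e.symm.map_adj_iff.2 h⟩
    refine hS.map φ ?_
    rintro ⟨v, hv⟩
    exact ⟨⟨e v, hv⟩, Subtype.ext (e.symm_apply_apply v)⟩
  · simpa using (hgS i).1
  · obtain ⟨x, hx, h⟩ := (hgS i).2
    exact ⟨e.symm x, by simpa using hx, e.symm.map_adj_iff.2 h⟩

open Classical in
theorem StarMinorFree.degree_lt [Fintype V] {t : ℕ} (hG : StarMinorFree t G) (v : V) :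
    G.degree v < t := by
  refine starMinorFree_iff.1 hG {v} (induce_singleton_connected v) (G.neighborFinset v) ?_
  intro y hy
  have : G.Adj v y := by simpa using hy
  exact ⟨fun h => G.ne_of_adj this h.symm, v, rfl, this⟩

/-- On `t + 1` vertices a connected set with `t` outside neighbours is a single vertex. -/
theorem starMinorFree_of_degree_lt [Fintype V] [∀ v, Fintype (G.neighborSet v)] {t : ℕ}
    (hV : Fintype.card V = t + 1) (h : ∀ v, G.degree v < t) : StarMinorFree t G := by
  classical
  refine starMinorFree_iff.2 fun S hS T hT => ?_
  obtain ⟨s, hs⟩ := hS.nonempty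
  by_contra! hcard
  have hle : (insert s T).card ≤ Fintype.card V := Finset.card_le_univ _
  have hsT : s ∉ T := fun h => (hT s h).1 hs
  rw [Finset.card_insert_of_notMem hsT] at hle
  have huniv : insert s T = Finset.univ := by
    rw [← Finset.card_eq_iff_eq_univ, Finset.card_insert_of_notMem hsT]
    omega
  have hsub : T ⊆ G.neighborFinset s := by
    intro y hy
    obtain ⟨-, x, hx, hxy⟩ := hT y hy
    have hxT : x ∈ insert s T := huniv ▸ Finset.mem_univ x
    rcases Finset.mem_insert.1 hxT with rfl | hxT
    · simpa using hxy
    · exact absurd hx (hT x hxT).1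
  have := Finset.card_le_card hsub
  rw [card_neighborFinset_eq_degree] at this
  have := h s
  omega

end Minor

/-! ### The extremal problem and graphs of bounded degree -/

/-- To solve the extremal problem it suffices to show that a competitor whose `Q`-index is at least
that of the candidate `H` is isomorphic to `H`. -/
theorem isExtremal_iff {t n : ℕ} {W : Type*} [Fintype W] (hW : Fintype.card W = n)
    {H : SimpleGraph W} (hc : H.Connected) (hf : StarMinorFree t H)
    (hkey : ∀ G : SimpleGraph (Fin n), G.Connected → StarMinorFree t G →
      qIndex H ≤ qIndex G → Nonempty (G ≃g H)) (G : SimpleGraph (Fin n)) :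
    IsExtremal t G ↔ Nonempty (G ≃g H) := by
  constructor
  · rintro ⟨h1, h2, h3⟩
    refine hkey G h1 h2 ?_
    let e : Fin n ≃ W := (Fintype.equivFinOfCardEq hW).symm
    have i : H.comap e ≃g H := ⟨e, by simp⟩
    rw [← qIndex_iso i]
    exact h3 _ (i.connected_iff.2 hc) (hf.of_iso i.symm)
  · rintro ⟨i⟩
    refine ⟨i.connected_iff.2 hc, hf.of_iso i.symm, fun G' h1 h2 => ?_⟩
    rw [qIndex_iso i]
    by_contra! hlt
    obtain ⟨j⟩ := hkey G' h1 h2 hlt.le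
    exact hlt.ne (qIndex_iso j).symm

section Degree

open Classical

variable {V : Type*} [Fintype V] {G : SimpleGraph V}

theorem qIndex_le_of_degree_le (hG : G.Connected) {D : ℕ} (hD : ∀ v, G.degree v ≤ D) :
    qIndex G ≤ 2 * D := by
  have := hG.nonempty
  obtain ⟨x, hx⟩ := exists_isPerronVector hG
  have hS : 0 < ∑ v, x v := Finset.sum_pos (fun v _ => hx.pos v) Finset.univ_nonempty
  refine le_of_mul_le_mul_right ?_ hS
  rw [hx.sum_eq, Finset.mul_sum]
  refine Finset.sum_le_sum fun v _ => mul_le_mul_of_nonneg_right ?_ (hx.pos v).le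
  have : (G.degree v : ℝ) ≤ D := by exact_mod_cast hD v
  linarith

/-- The equality case of `qIndex_le_of_degree_le`. -/
theorem degree_eq_of_le_qIndex (hG : G.Connected) {D : ℕ} (hD : ∀ v, G.degree v ≤ D)
    (hq : 2 * D ≤ qIndex G) (v : V) : G.degree v = D := by
  obtain ⟨x, hx⟩ := exists_isPerronVector hG
  have h1 : ∑ v, (2 * (D : ℝ) - 2 * G.degree v) * x v ≤ 0 := by
    simp only [sub_mul, Finset.sum_sub_distrib, ← hx.sum_eq, ← Finset.mul_sum]
    have hS : 0 ≤ ∑ v, x v := Finset.sum_nonneg fun v _ => (hx.pos v).le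
    nlinarith
  have h2 : ∀ v ∈ Finset.univ, 0 ≤ (2 * (D : ℝ) - 2 * G.degree v) * x v := by
    intro v _
    have : (G.degree v : ℝ) ≤ D := by exact_mod_cast hD v
    exact mul_nonneg (by linarith) (hx.pos v).le
  have h3 := (Finset.sum_eq_zero_iff_of_nonneg h2).1 (le_antisymm h1 (Finset.sum_nonneg h2)) v
    (Finset.mem_univ v)
  have h4 := (mul_eq_zero.1 h3).resolve_right (hx.pos v).ne'
  have h5 : (G.degree v : ℝ) = D := by linarith
  exact_mod_cast h5

/-- The Rayleigh bound for the all-ones vector. -/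
theorem two_mul_sum_degree_le (G : SimpleGraph V) [Nonempty V] :
    ∑ v, 2 * (G.degree v : ℝ) ≤ qIndex G * Fintype.card V := by
  have h := quadraticForm_le G (fun _ => 1)
  simp only [dotProduct, signlessLaplacian_mulVec_apply, Finset.sum_const, nsmul_eq_mul,
    card_neighborFinset_eq_degree, one_pow, one_mul, mul_one, Finset.card_univ] at h
  refine le_trans (le_of_eq ?_) h
  exact Finset.sum_congr rfl fun v _ => by ring

/-- If all degrees are at most `D` and the `Q`-index is close enough to its upper bound `2 * D`,
then a vertex where the Perron vector is largest, and all of its neighbours, have degree `D`: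
the neighbours have entries close to the maximum, and a smaller degree would force a small
entry. -/
theorem exists_degree_eq_of_qIndex_eq (hG : G.Connected) {D : ℕ} (hD : ∀ v, G.degree v ≤ D) {δ : ℝ}
    (hq : qIndex G = 2 * D - δ) (hδ2 : δ < 2) (hδ : (D + 2) * δ - δ ^ 2 < 2) :
    ∃ v, G.degree v = D ∧ ∀ u, G.Adj v u → G.degree u = D := by
  have := hG.nonempty
  obtain ⟨x, hx⟩ := exists_isPerronVector hG
  obtain ⟨v, hv⟩ := Finite.exists_max x
  have hM := hx.pos v
  have hsum : ∀ u, ∑ w ∈ G.neighborFinset u, x w ≤ G.degree u * x v := by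
    intro u
    rw [← card_neighborFinset_eq_degree, ← nsmul_eq_mul]
    exact Finset.sum_le_card_nsmul _ _ _ fun w _ => hv w
  have hdv : G.degree v = D := by
    by_contra hne
    have hlt : G.degree v + 1 ≤ D := lt_of_le_of_ne (hD v) hne
    have hlt' : (G.degree v : ℝ) + 1 ≤ D := by exact_mod_cast hlt
    have h1 := hsum v
    have h2 := hx.sum_neighbors v
    rw [hq] at h2
    have h3 : (2 * D - δ - 2 * G.degree v) * x v ≤ 0 := by linarith
    have h4 : 0 < (2 * D - δ - 2 * G.degree v) * x v := mul_pos (by linarith) hM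
    linarith
  refine ⟨v, hdv, fun u huv => ?_⟩
  by_contra hne
  have hlt : G.degree u + 1 ≤ D := lt_of_le_of_ne (hD u) hne
  have hlt' : (G.degree u : ℝ) + 1 ≤ D := by exact_mod_cast hlt
  have hgap : x v - x u ≤ δ * x v := by
    have h1 : ∑ w ∈ G.neighborFinset v, (x v - x w) = δ * x v := by
      have h2 := hx.sum_neighbors v
      rw [hq, hdv] at h2
      rw [Finset.sum_sub_distrib, Finset.sum_const, card_neighborFinset_eq_degree, hdv,
        nsmul_eq_mul]
      linarith
    rw [← h1]
    exact Finset.single_le_sum (f := fun w => x v - x w) (fun w _ => sub_nonneg.2 (hv w))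
      (by simpa using huv)
  have hu := hx.sum_neighbors u
  rw [hq] at hu
  have hu' := hsum u
  have hxu := hx.pos u
  have h1 : (D + 1 - δ) * x u ≤ (D - 1) * x v := by nlinarith
  have hd0 : (0 : ℝ) ≤ G.degree u := Nat.cast_nonneg _
  have h2 : (D + 1 - δ) * ((1 - δ) * x v) ≤ (D + 1 - δ) * x u :=
    mul_le_mul_of_nonneg_left (by linarith) (by linarith)
  have h3 : 0 < (2 - ((D + 2) * δ - δ ^ 2)) * x v := mul_pos (by linarith) hM
  linarith

theorem degree_add_card_of_mem_iff {v : V} {B : Finset V}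
    (hB : ∀ u, u ∈ B ↔ u ≠ v ∧ ¬ G.Adj v u) : G.degree v + (B.card + 1) = Fintype.card V := by
  have h : G.neighborFinset v = (insert v B)ᶜ := by
    ext u
    by_cases h : u = v
    · simp [h]
    · simp [hB, h]
  have hv : v ∉ B := fun h => ((hB v).1 h).1 rfl
  have hle : (insert v B).card ≤ Fintype.card V := Finset.card_le_univ _
  rw [← card_neighborFinset_eq_degree, h, Finset.card_compl]
  rw [Finset.card_insert_of_notMem hv] at hle ⊢
  omega

theorem connected_of_le_degree_add_degree [Nonempty V]
    (h : ∀ u v : V, u ≠ v → Fintype.card V ≤ G.degree u + G.degree v + 1) : G.Connected := by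
  refine ⟨fun u v => ?_⟩
  by_cases huv : u = v
  · exact huv ▸ Reachable.refl _
  by_cases hadj : G.Adj u v
  · exact hadj.reachable
  have hc : ({u, v} : Finset V)ᶜ.card + 2 = Fintype.card V := by
    have hle : ({u, v} : Finset V).card ≤ Fintype.card V := Finset.card_le_univ _
    rw [Finset.card_compl]
    rw [Finset.card_pair huv] at hle ⊢
    omega
  have hu : G.neighborFinset u ⊆ ({u, v} : Finset V)ᶜ := by
    intro w hw
    have hw' : G.Adj u w := by simpa using hw
    simp only [Finset.mem_compl, Finset.mem_insert, Finset.mem_singleton]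
    rintro (rfl | rfl)
    · exact G.irrefl hw'
    · exact hadj hw'
  have hv : G.neighborFinset v ⊆ ({u, v} : Finset V)ᶜ := by
    intro w hw
    have hw' : G.Adj v w := by simpa using hw
    simp only [Finset.mem_compl, Finset.mem_insert, Finset.mem_singleton]
    rintro (rfl | rfl)
    · exact hadj hw'.symm
    · exact G.irrefl hw'
  obtain ⟨w, hw⟩ := Finset.inter_nonempty_of_card_lt_card_add_card hu hv (by
    have := h u v huv
    rw [card_neighborFinset_eq_degree, card_neighborFinset_eq_degree]
    omega)
  have h1 : G.Adj u w ∧ G.Adj v w := by simpa using hw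
  exact h1.1.reachable.trans h1.2.symm.reachable

/-! ### Graphs on `t + 1` vertices -/

/-- The `Q`-index of a graph in which all vertices but `w` have exactly one non-neighbour, while `w`
has `a` of them, satisfies a cubic equation. It comes from the eigenvalue equation at `w`, the sum
of those at the non-neighbours of `w`, and the sum of all of them. -/
theorem qIndex_equation (hG : G.Connected) {a : ℕ} {w : V}
    (hdeg : ∀ v, v ≠ w → G.degree v + 2 = Fintype.card V)
    (hw : G.degree w + (a + 1) = Fintype.card V) {δ : ℝ}
    (hq : qIndex G = 2 * (Fintype.card V - 2) - δ) :
    δ * (Fintype.card V - 2 - δ) * (Fintype.card V - 1 - δ + a) =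
      2 * (a - 1) * (Fintype.card V - 1 - δ - a) := by
  obtain ⟨x, hx⟩ := exists_isPerronVector hG
  set n : ℝ := ((Fintype.card V : ℕ) : ℝ) with hn
  set S := ∑ v, x v with hS
  let L : Finset V := Finset.univ.filter fun l => l ≠ w ∧ ¬ G.Adj w l
  have hLa : L.card = a := by
    have := degree_add_card_of_mem_iff (G := G) (v := w) (B := L) (by simp [L])
    omega
  have hdegw : (G.degree w : ℝ) = n - 1 - a := by
    have : ((G.degree w + (a + 1) : ℕ) : ℝ) = n := by rw [hw]
    push_cast at this
    linarith
  have hdeg' : ∀ v, v ≠ w → (G.degree v : ℝ) = n - 2 := by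
    intro v hv
    have : ((G.degree v + 2 : ℕ) : ℝ) = n := by rw [hdeg v hv]
    push_cast at this
    linarith
  have hsum : δ * S = 2 * (a - 1) * x w := by
    have h1 := hx.sum_eq
    have h2 : ∑ v, 2 * (G.degree v : ℝ) * x v =
        ∑ v, (2 * (n - 2) * x v - if v = w then 2 * (a - 1) * x w else 0) := by
      refine Finset.sum_congr rfl fun v _ => ?_
      split_ifs with h
      · rw [h, hdegw]
        ring
      · rw [hdeg' v h]
        ring
    rw [h2, Finset.sum_sub_distrib, ← Finset.mul_sum, Finset.sum_ite_eq' Finset.univ w,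
      if_pos (Finset.mem_univ w), hq, ← hS] at h1
    linarith
  have hcenter : (n - 2 - δ + a) * x w = S - ∑ l ∈ L, x l := by
    have h1 := hx.sum_neighbors w
    have h2 : G.neighborFinset w = (insert w L)ᶜ := by
      ext u
      by_cases h : u = w
      · simp [h]
      · simp [L, h]
    have h3 := Finset.sum_add_sum_compl (insert w L) x
    rw [Finset.sum_insert (by simp [L])] at h3
    rw [h2, hq, hdegw] at h1
    linarith
  have hleaf : (n - 1 - δ) * ∑ l ∈ L, x l = a * S - a * x w := by
    have h1 : ∀ l ∈ L, (n - 1 - δ) * x l = S - x w := by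
      intro l hl
      obtain ⟨hlw, hadj⟩ : l ≠ w ∧ ¬ G.Adj w l := by simpa [L] using hl
      have h1 := hx.sum_neighbors l
      have h2 : G.neighborFinset l = ({l, w} : Finset V)ᶜ := by
        refine Finset.eq_of_subset_of_card_le ?_ ?_
        · intro u hu
          have hu' : G.Adj l u := by simpa using hu
          simp only [Finset.mem_compl, Finset.mem_insert, Finset.mem_singleton]
          rintro (rfl | rfl)
          · exact G.irrefl hu'
          · exact hadj hu'.symm
        · have := hdeg l hlw
          rw [Finset.card_compl, Finset.card_pair hlw, card_neighborFinset_eq_degree]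
          omega
      have h3 := Finset.sum_add_sum_compl ({l, w} : Finset V) x
      rw [Finset.sum_pair hlw] at h3
      rw [h2, hq, hdeg' l hlw] at h1
      linarith
    rw [Finset.mul_sum, Finset.sum_congr rfl h1, Finset.sum_const, hLa, nsmul_eq_mul]
    ring
  have hw0 := hx.pos w
  have hL : ∑ l ∈ L, x l = S - (n - 2 - δ + a) * x w := by linarith
  rw [hL] at hleaf
  refine mul_right_cancel₀ hw0.ne' ?_
  linear_combination (n - 1 - δ - a) * hsum - δ * hleaf

/-- A comparison of two instances of the equation of `qIndex_equation`, with `2` and with `a > 2`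
non-neighbours: the deficits `δ'` and `δ` of the `Q`-index cannot satisfy `δ ≤ δ'`. After
eliminating `δ` from the equations, `(a - 2) * ((n - δ - 1) ^ 2 - (n - δ + 1) * a) ≤ 0` remains. -/
theorem false_of_star_equations {n a δ δ' : ℝ} (hn : 5 ≤ n) (h0 : 0 ≤ δ) (hle : δ ≤ δ')
    (hδ' : n * δ' ≤ 2) (e' : δ' * (n - 2 - δ') * (n + 1 - δ') = 2 * (n - 3 - δ'))
    (e : δ * (n - 2 - δ) * (n - 1 - δ + a) = 2 * (a - 1) * (n - 1 - δ - a))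
    (ha : 2 < a) (ha' : a ≤ n - 3) : False := by
  have hd' : δ' ≤ 2 / 5 := by nlinarith
  have hnd : n * δ ≤ 2 := by nlinarith
  have hd : δ ≤ 2 / 5 := by linarith
  -- `δ ↦ δ * (n - 2 - δ) * (n + 1 - δ) - 2 * (n - 3 - δ)` is increasing on the relevant range
  have hmono : δ * (n - 2 - δ) * (n + 1 - δ) ≤ 2 * (n - 3 - δ) := by
    have hA : 4 ≤ (n - 2 - δ') * (n + 1 - δ') := by nlinarith
    have hB : δ * (2 * n - 1 - δ - δ') ≤ 4 := by nlinarith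
    have hC : 0 ≤ (δ' - δ) *
        ((n - 2 - δ') * (n + 1 - δ') - δ * (2 * n - 1 - δ - δ') + 2) :=
      mul_nonneg (by linarith) (by linarith)
    linarith
  have h1 : 2 * (a - 1) * (n - 1 - δ - a) * (n + 1 - δ) ≤
      2 * (n - 3 - δ) * (n - 1 - δ + a) := by
    rw [← e]
    have := mul_le_mul_of_nonneg_right hmono (show 0 ≤ n - 1 - δ + a by linarith)
    linarith
  have h2 : (a - 2) * ((n - δ - 1) ^ 2 - (n - δ + 1) * a) ≤ 0 := by linarith
  have h3 : 0 < (n - δ - 1) ^ 2 - (n - δ + 1) * a := by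
    have : (n - δ + 1) * a ≤ (n - δ + 1) * (n - 3) :=
      mul_le_mul_of_nonneg_left ha' (by linarith)
    nlinarith
  have := mul_pos (show 0 < a - 2 by linarith) h3
  linarith

end Degree

/-! ### Perfect matchings and the standard pairing -/

/-- The pairs `{0, 1}, {2, 3}, …` of natural numbers, as a symmetric relation. -/
def IsPaired (i j : ℕ) : Prop :=
  (Even i ∧ j = i + 1) ∨ (Even j ∧ i = j + 1)

theorem isPaired_comm {i j : ℕ} : IsPaired i j ↔ IsPaired j i := or_comm

theorem mem_pairing_iff {n : ℕ} {i j : Fin n} :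
    s(i, j) ∈ pairing n ↔ IsPaired i.val j.val := by
  constructor
  · rintro ⟨a, b, ha, hab, h⟩
    rcases Sym2.eq_iff.1 h with ⟨rfl, rfl⟩ | ⟨rfl, rfl⟩
    · exact Or.inl ⟨ha, hab⟩
    · exact Or.inr ⟨ha, hab⟩
  · rintro (⟨h1, h2⟩ | ⟨h1, h2⟩)
    · exact ⟨i, j, h1, h2, rfl⟩
    · exact ⟨j, i, h1, h2, Sym2.eq_swap⟩

section Pairing

variable {V : Type*}

/-- A graph that induces a perfect matching on `A` is on `A` a copy of the standard pairing. -/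
theorem exists_isPaired (H : SimpleGraph V) (A : Finset V)
    (hA : ∀ u ∈ A, ∃ w ∈ A, H.Adj u w ∧ ∀ z ∈ A, H.Adj u z → z = w) :
    Even A.card ∧ ∃ φ : V → ℕ, Set.InjOn φ A ∧ (∀ v ∈ A, φ v < A.card) ∧
      ∀ u ∈ A, ∀ v ∈ A, H.Adj u v ↔ IsPaired (φ u) (φ v) := by
  classical
  induction hk : A.card using Nat.strong_induction_on generalizing A with
  | _ k ih =>
    rcases A.eq_empty_or_nonempty with rfl | ⟨u, hu⟩
    · subst hk
      exact ⟨by simp, fun _ => 0, by simp⟩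
    obtain ⟨w, hw, huw, huniq⟩ := hA u hu
    have hne : u ≠ w := H.ne_of_adj huw
    have hwuniq : ∀ z ∈ A, H.Adj w z → z = u := by
      obtain ⟨w', -, -, h⟩ := hA w hw
      intro z hz hwz
      rw [h z hz hwz, h u hu huw.symm]
    let A' := (A.erase u).erase w
    have hcard : A'.card + 2 = A.card := by
      have h1 := Finset.card_erase_add_one hu
      have h2 := Finset.card_erase_add_one (Finset.mem_erase.2 ⟨hne.symm, hw⟩)
      change ((A.erase u).erase w).card + 2 = A.card
      omega
    have hmem : ∀ z, z ∈ A' ↔ z ≠ w ∧ z ≠ u ∧ z ∈ A := by simp [A']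
    have hA' : ∀ z ∈ A', ∃ y ∈ A', H.Adj z y ∧ ∀ x ∈ A', H.Adj z x → x = y := by
      intro z hz
      obtain ⟨hzw, hzu, hzA⟩ := (hmem z).1 hz
      obtain ⟨y, hy, hzy, h⟩ := hA z hzA
      refine ⟨y, (hmem y).2 ⟨?_, ?_, hy⟩, hzy, fun x hx => h x ((hmem x).1 hx).2.2⟩
      · rintro rfl
        exact hzu (hwuniq z hzA hzy.symm)
      · rintro rfl
        exact hzw (huniq z hzA hzy.symm)
    obtain ⟨heven, φ, hinj, hlt, hφ⟩ := ih A'.card (by omega) A' hA' rfl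
    have hsplit : ∀ z ∈ A, z = u ∨ z = w ∨ (z ≠ u ∧ z ≠ w ∧ z ∈ A') := by
      intro z hz
      by_cases h1 : z = u
      · exact Or.inl h1
      by_cases h2 : z = w
      · exact Or.inr (Or.inl h2)
      exact Or.inr (Or.inr ⟨h1, h2, (hmem z).2 ⟨h2, h1, hz⟩⟩)
    let ψ : V → ℕ := fun z => if z = u then A'.card else if z = w then A'.card + 1 else φ z
    have hψu : ψ u = A'.card := if_pos rfl
    have hψw : ψ w = A'.card + 1 := by simp [ψ, hne.symm]
    have hψ : ∀ z, z ≠ u → z ≠ w → ψ z = φ z := fun z h1 h2 => by simp [ψ, h1, h2]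
    refine ⟨by rw [← hk, ← hcard]; exact heven.add even_two, ψ, ?_, ?_, ?_⟩
    · intro y hy z hz hyz
      rcases hsplit y hy with rfl | rfl | ⟨h1, h2, h3⟩ <;>
      rcases hsplit z hz with rfl | rfl | ⟨h4, h5, h6⟩
      · rfl
      · omega
      · have := hlt z h6
        have := hψ z h4 h5
        omega
      · omega
      · rfl
      · have := hlt z h6
        have := hψ z h4 h5
        omega
      · have := hlt y h3
        have := hψ y h1 h2
        omega
      · have := hlt y h3
        have := hψ y h1 h2
        omega
      · rw [hψ y h1 h2, hψ z h4 h5] at hyz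
        exact hinj h3 h6 hyz
    · intro z hz
      rcases hsplit z hz with rfl | rfl | ⟨h1, h2, h3⟩
      · omega
      · omega
      · have := hlt z h3
        have := hψ z h1 h2
        omega
    · have hnew : ∀ z ∈ A', ∀ i, i = A'.card ∨ i = A'.card + 1 → ¬ IsPaired i (φ z) := by
        intro z hz i hi h
        have := hlt z hz
        rcases hi with rfl | rfl <;> rcases h with ⟨h, h'⟩ | ⟨h, h'⟩ <;> grind
      have hpair : IsPaired A'.card (A'.card + 1) := Or.inl ⟨heven, rfl⟩
      have hirr : ∀ i, ¬ IsPaired i i := by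
        rintro i (⟨_, h⟩ | ⟨_, h⟩) <;> omega
      have hmixed : ∀ y z, y = u ∨ y = w → z ≠ u → z ≠ w → z ∈ A' →
          (H.Adj y z ↔ IsPaired (ψ y) (ψ z)) := by
        intro y z hy h1 h2 h3
        rw [hψ z h1 h2]
        have hzA := ((hmem z).1 h3).2.2
        rcases hy with rfl | rfl
        · exact iff_of_false (fun h => h2 (huniq z hzA h)) (hnew z h3 _ (Or.inl hψu))
        · exact iff_of_false (fun h => h1 (hwuniq z hzA h)) (hnew z h3 _ (Or.inr hψw))
      intro y hy z hz
      rcases hsplit y hy with hyu | hyw | ⟨h1, h2, h3⟩ <;>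
      rcases hsplit z hz with hzu | hzw | ⟨h4, h5, h6⟩
      · rw [hyu, hzu]
        exact iff_of_false H.irrefl (hirr _)
      · rw [hyu, hzw, hψu, hψw]
        exact iff_of_true huw hpair
      · exact hmixed y z (Or.inl hyu) h4 h5 h6
      · rw [hyw, hzu, hψu, hψw]
        exact iff_of_true huw.symm (isPaired_comm.1 hpair)
      · rw [hyw, hzw]
        exact iff_of_false H.irrefl (hirr _)
      · exact hmixed y z (Or.inr hyw) h4 h5 h6
      · rw [H.adj_comm, isPaired_comm]
        exact hmixed z y (Or.inl hzu) h1 h2 h3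
      · rw [H.adj_comm, isPaired_comm]
        exact hmixed z y (Or.inr hzw) h1 h2 h3
      · rw [hψ y h1 h2, hψ z h4 h5]
        exact hφ y h3 z h6

theorem nonempty_iso_deleteEdges [Fintype V] {n : ℕ} (hn : Fintype.card V = n)
    {G : SimpleGraph V} {E : Set (Sym2 (Fin n))} (φ : V → ℕ) (hinj : Function.Injective φ)
    (hlt : ∀ v, φ v < n)
    (hE : ∀ u v, Gᶜ.Adj u v ↔ s((⟨φ u, hlt u⟩ : Fin n), (⟨φ v, hlt v⟩ : Fin n)) ∈ E) :
    Nonempty (G ≃g (⊤ : SimpleGraph (Fin n)).deleteEdges E) := by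
  let f : V → Fin n := fun v => ⟨φ v, hlt v⟩
  have hf : Function.Bijective f := by
    rw [Fintype.bijective_iff_injective_and_card]
    exact ⟨fun u v h => hinj (congrArg Fin.val h), by simp [hn]⟩
  refine ⟨⟨Equiv.ofBijective f hf, fun {u v} => ?_⟩⟩
  have h1 : f u = f v ↔ u = v := hf.1.eq_iff
  have h2 := hE u v
  rw [compl_adj] at h2
  have h3 : G.Adj u v → u ≠ v := G.ne_of_adj
  simp only [Equiv.ofBijective_apply, deleteEdges_adj, top_adj]
  change (f u ≠ f v ∧ s(f u, f v) ∉ E) ↔ _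
  rw [← h2, Ne, h1]
  tauto

end Pairing

section SmallOrder

open Classical

variable {n : ℕ}

/-! ### Order `t + 1`, even -/

theorem degree_deleteEdges_pairing (hn : Even n) {H : SimpleGraph (Fin n)}
    (hH : H = (⊤ : SimpleGraph (Fin n)).deleteEdges (pairing n)) (v : Fin n) :
    H.degree v + 2 = n := by
  have hv := v.2
  obtain ⟨w, hw⟩ : ∃ w : Fin n, ∀ u : Fin n, IsPaired v.val u.val ↔ u = w := by
    by_cases h : Even v.val
    · refine ⟨⟨v.val + 1, by grind⟩, fun u => ?_⟩
      rw [Fin.ext_iff, IsPaired]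
      grind
    · refine ⟨⟨v.val - 1, by grind⟩, fun u => ?_⟩
      rw [Fin.ext_iff, IsPaired]
      grind
  have h := degree_add_card_of_mem_iff (G := H) (v := v) (B := {w}) (fun u => by
    simp only [hH, Finset.mem_singleton, deleteEdges_adj, top_adj, mem_pairing_iff, hw]
    have : u = w → u ≠ v := by
      rintro rfl rfl
      have := (hw u).2 rfl
      rw [IsPaired] at this
      grind
    have h2 : u ≠ v ↔ v ≠ u := ne_comm
    tauto)
  simpa using h

theorem nonempty_iso_of_degree {G : SimpleGraph (Fin n)} (hG : ∀ v, G.degree v + 2 = n) :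
    Nonempty (G ≃g (⊤ : SimpleGraph (Fin n)).deleteEdges (pairing n)) := by
  have hdeg : ∀ v, Gᶜ.degree v = 1 := by
    intro v
    have := hG v
    rw [degree_compl, Fintype.card_fin]
    omega
  obtain ⟨-, φ, hinj, hlt, hφ⟩ := exists_isPaired Gᶜ Finset.univ (by
    intro u _
    obtain ⟨w, hw, h⟩ := degree_eq_one_iff_existsUnique_adj.1 (hdeg u)
    exact ⟨w, Finset.mem_univ w, hw, fun z _ => h z⟩)
  refine nonempty_iso_deleteEdges (Fintype.card_fin n) φ (fun u v h => hinj (by simp) (by simp) h)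
    (fun v => by simpa using hlt v (Finset.mem_univ v)) fun u v => ?_
  rw [hφ u (Finset.mem_univ u) v (Finset.mem_univ v), mem_pairing_iff]

theorem isExtremal_iff_of_even {t : ℕ} (ht : 3 ≤ t) (hn : n = t + 1) (he : Even n)
    (G : SimpleGraph (Fin n)) :
    IsExtremal t G ↔ Nonempty (G ≃g (⊤ : SimpleGraph (Fin n)).deleteEdges (pairing n)) := by
  have : Nonempty (Fin n) := ⟨⟨0, by omega⟩⟩
  obtain ⟨H, hH⟩ : ∃ H, H = (⊤ : SimpleGraph (Fin n)).deleteEdges (pairing n) := ⟨_, rfl⟩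
  rw [← hH]
  have hdeg := degree_deleteEdges_pairing he hH
  have hconn : H.Connected := connected_of_le_degree_add_degree fun u v _ => by
    have := hdeg u
    have := hdeg v
    rw [Fintype.card_fin]
    omega
  refine isExtremal_iff (Fintype.card_fin n) hconn
    (starMinorFree_of_degree_lt (by simp [hn]) fun v => by have := hdeg v; omega) ?_ G
  intro G' h1 h2 hq
  rw [hH]
  refine nonempty_iso_of_degree fun v => ?_
  have hq' : 2 * ((t - 1 : ℕ) : ℝ) ≤ qIndex H := by
    have h := two_mul_sum_degree_le H
    have hd : ∀ v, (H.degree v : ℝ) = (t - 1 : ℕ) := fun v => by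
      congr 1
      have := hdeg v
      omega
    simp only [hd, Finset.sum_const, Finset.card_univ, Fintype.card_fin, nsmul_eq_mul] at h
    have hn0 : (0 : ℝ) < n := by
      rw [hn]
      positivity
    exact le_of_mul_le_mul_right (by linarith) hn0
  have := degree_eq_of_le_qIndex h1 (D := t - 1) (fun v => by have := h2.degree_lt v; omega)
    (hq'.trans hq) v
  omega

/-! ### Order `t + 1`, odd -/

theorem mem_pairing_union_iff (hn : 2 < n) {i j : Fin n} :
    s(i, j) ∈ pairing n ∪
        {s((⟨n - 2, by omega⟩ : Fin n), (⟨n - 1, by omega⟩ : Fin n))} ↔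
      IsPaired i.val j.val ∨ (i.val = n - 2 ∧ j.val = n - 1) ∨ (i.val = n - 1 ∧ j.val = n - 2) := by
  rw [Set.mem_union, mem_pairing_iff, Set.mem_singleton_iff, Sym2.eq_iff]
  simp only [Fin.ext_iff]

theorem degree_deleteEdges_pairing_union (hn : 2 < n) (ho : Odd n) {H : SimpleGraph (Fin n)}
    (hH : H = (⊤ : SimpleGraph (Fin n)).deleteEdges (pairing n ∪
      {s((⟨n - 2, by omega⟩ : Fin n), (⟨n - 1, by omega⟩ : Fin n))})) (v : Fin n) :
    H.degree v + (if v.val = n - 2 then 3 else 2) = n := by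
  have hv := v.2
  obtain ⟨B, hcard, hB⟩ : ∃ B : Finset (Fin n), B.card + 1 = (if v.val = n - 2 then 3 else 2) ∧
      ∀ u : Fin n, u ∈ B ↔ (IsPaired v.val u.val ∨ (v.val = n - 2 ∧ u.val = n - 1) ∨
        (v.val = n - 1 ∧ u.val = n - 2)) := by
    by_cases h2 : v.val = n - 2
    · refine ⟨{⟨n - 3, by omega⟩, ⟨n - 1, by omega⟩}, ?_, fun u => ?_⟩
      · rw [Finset.card_pair (by rw [Ne, Fin.ext_iff]; simp only; omega), if_pos h2]
      · simp only [Finset.mem_insert, Finset.mem_singleton, Fin.ext_iff, IsPaired]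
        grind
    by_cases h1 : v.val = n - 1
    · refine ⟨{⟨n - 2, by omega⟩}, by simp [h2], fun u => ?_⟩
      simp only [Finset.mem_singleton, Fin.ext_iff, IsPaired]
      grind
    by_cases h : Even v.val
    · refine ⟨{⟨v.val + 1, by grind⟩}, by simp [h2], fun u => ?_⟩
      simp only [Finset.mem_singleton, Fin.ext_iff, IsPaired]
      grind
    · refine ⟨{⟨v.val - 1, by grind⟩}, by simp [h2], fun u => ?_⟩
      simp only [Finset.mem_singleton, Fin.ext_iff, IsPaired]
      grind
  have h := degree_add_card_of_mem_iff (G := H) (v := v) (B := B) (fun u => by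
    rw [hH, deleteEdges_adj, top_adj, mem_pairing_union_iff hn, hB, Ne, Ne, Fin.ext_iff,
      Fin.ext_iff, IsPaired]
    grind)
  rwa [hcard, Fintype.card_fin] at h

/-- The complement consists of a path with two edges, centred at `w`, and single edges; the path is
placed on the last three positions. -/
theorem nonempty_iso_of_degree_of_odd (hn : 2 < n) {G : SimpleGraph (Fin n)} {w : Fin n}
    (hw : G.degree w + 3 = n) (hG : ∀ v, v ≠ w → G.degree v + 2 = n) :
    Nonempty (G ≃g (⊤ : SimpleGraph (Fin n)).deleteEdges (pairing n ∪
      {s((⟨n - 2, by omega⟩ : Fin n), (⟨n - 1, by omega⟩ : Fin n))})) := by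
  have hdeg : ∀ v, v ≠ w → ∀ y z, Gᶜ.Adj v y → Gᶜ.Adj v z → z = y := by
    intro v hv y z hy hz
    have h1 : Gᶜ.degree v = 1 := by
      have := hG v hv
      rw [degree_compl, Fintype.card_fin]
      omega
    obtain ⟨y', _, h⟩ := degree_eq_one_iff_existsUnique_adj.1 h1
    rw [h y hy, h z hz]
  have hex : ∀ v, v ≠ w → ∃ y, Gᶜ.Adj v y := by
    intro v hv
    have h1 : Gᶜ.degree v = 1 := by
      have := hG v hv
      rw [degree_compl, Fintype.card_fin]
      omega
    exact (degree_eq_one_iff_existsUnique_adj.1 h1).exists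
  obtain ⟨a, b, hab, hN⟩ : ∃ a b, a ≠ b ∧ Gᶜ.neighborFinset w = {a, b} := by
    rw [← Finset.card_eq_two, card_neighborFinset_eq_degree, degree_compl, Fintype.card_fin]
    omega
  have hwN : ∀ z, Gᶜ.Adj w z ↔ z = a ∨ z = b := by
    intro z
    rw [← mem_neighborFinset, hN]
    simp
  have hwa := (hwN a).2 (Or.inl rfl)
  have hwb := (hwN b).2 (Or.inr rfl)
  have haw : a ≠ w := hwa.ne'
  have hbw : b ≠ w := hwb.ne'
  let A : Finset (Fin n) := ((Finset.univ.erase w).erase a).erase b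
  have hmem : ∀ z, z ∈ A ↔ z ≠ b ∧ z ≠ a ∧ z ≠ w := by simp [A]
  have hcard : A.card + 3 = n := by
    have h1 := Finset.card_erase_add_one (Finset.mem_univ w)
    have h2 := Finset.card_erase_add_one (s := Finset.univ.erase w) (a := a) (by simp [haw])
    have h3 := Finset.card_erase_add_one (s := (Finset.univ.erase w).erase a) (a := b)
      (by simp [hbw, hab.symm])
    rw [Finset.card_univ, Fintype.card_fin] at h1
    change (((Finset.univ.erase w).erase a).erase b).card + 3 = n
    omega
  -- `w` is adjacent to both `a` and `b` in the complement, so neither has a neighbour in `A`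
  have hout : ∀ z ∈ A, ¬ Gᶜ.Adj w z ∧ ¬ Gᶜ.Adj a z ∧ ¬ Gᶜ.Adj b z := by
    intro z hz
    obtain ⟨h1, h2, h3⟩ := (hmem z).1 hz
    refine ⟨fun h => ?_, fun h => h3 (hdeg a haw w z hwa.symm h),
      fun h => h3 (hdeg b hbw w z hwb.symm h)⟩
    rcases (hwN z).1 h with h | h
    · exact h2 h
    · exact h1 h
  have hnab : ¬ Gᶜ.Adj a b := fun h => hbw (hdeg a haw w b hwa.symm h)
  obtain ⟨heven, φ, hinj, hlt, hφ⟩ := exists_isPaired Gᶜ A (by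
    intro u hu
    have huw := ((hmem u).1 hu).2.2
    obtain ⟨y, hy⟩ := hex u huw
    refine ⟨y, (hmem y).2 ⟨?_, ?_, ?_⟩, hy, fun z _ hz => hdeg u huw y z hy hz⟩
    · rintro rfl
      exact (hout u hu).2.2 hy.symm
    · rintro rfl
      exact (hout u hu).2.1 hy.symm
    · rintro rfl
      exact (hout u hu).1 hy.symm)
  let ψ : Fin n → ℕ := fun z =>
    if z = a then A.card else if z = w then A.card + 1 else if z = b then A.card + 2 else φ z
  have hψa : ψ a = A.card := if_pos rfl
  have hψw : ψ w = A.card + 1 := by simp [ψ, haw.symm]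
  have hψb : ψ b = A.card + 2 := by simp [ψ, hab.symm, hbw]
  have hψ : ∀ z ∈ A, ψ z = φ z := by
    intro z hz
    obtain ⟨h1, h2, h3⟩ := (hmem z).1 hz
    simp [ψ, h1, h2, h3]
  have hsplit : ∀ z, z = a ∨ z = w ∨ z = b ∨ z ∈ A := by
    intro z
    rw [hmem]
    tauto
  have hψlt : ∀ z ∈ A, ψ z < A.card := fun z hz => (hψ z hz).symm ▸ hlt z hz
  have hψinj : ∀ y ∈ A, ∀ z ∈ A, ψ y = ψ z → y = z := by
    intro y hy z hz h
    rw [hψ y hy, hψ z hz] at h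
    exact hinj hy hz h
  have hψpair : ∀ y ∈ A, ∀ z ∈ A, (Gᶜ.Adj y z ↔ IsPaired (ψ y) (ψ z)) := by
    intro y hy z hz
    rw [hψ y hy, hψ z hz]
    exact hφ y hy z hz
  clear_value ψ
  refine nonempty_iso_deleteEdges (Fintype.card_fin n) ψ ?_ ?_ ?_
  · intro y z h
    rcases hsplit y with rfl | rfl | rfl | hy <;> rcases hsplit z with rfl | rfl | rfl | hz <;>
      grind
  · intro z
    rcases hsplit z with rfl | rfl | rfl | hz
    · omega
    · omega
    · omega
    · have := hψlt z hz
      omega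
  · have hA : n - 2 = A.card + 1 := by omega
    have hA' : n - 1 = A.card + 2 := by omega
    have hirr : ∀ z, ¬ Gᶜ.Adj z z := fun z => Gᶜ.irrefl
    have hsymm : ∀ y z, Gᶜ.Adj y z ↔ Gᶜ.Adj z y := fun y z => Gᶜ.adj_comm y z
    intro y z
    rw [mem_pairing_union_iff hn]
    simp only [hA, hA']
    rcases hsplit y with hy | hy | hy | hy <;> rcases hsplit z with hz | hz | hz | hz
    all_goals try rw [hψpair y hy z hz]
    all_goals try subst hy
    all_goals try subst hz
    all_goals simp only [IsPaired] at *
    all_goals grind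

theorem isExtremal_iff_of_odd {t : ℕ} (ht : 3 ≤ t) (hn : n = t + 1) (ho : Odd n)
    (G : SimpleGraph (Fin n)) :
    IsExtremal t G ↔ Nonempty (G ≃g (⊤ : SimpleGraph (Fin n)).deleteEdges (pairing n ∪
      {s((⟨n - 2, by omega⟩ : Fin n), (⟨n - 1, by omega⟩ : Fin n))})) := by
  have hn2 : 2 < n := by omega
  have hn5 : 5 ≤ n := by
    obtain ⟨k, hk⟩ := ho
    omega
  have hn5' : (5 : ℝ) ≤ n := by exact_mod_cast hn5
  have : Nonempty (Fin n) := ⟨⟨0, by omega⟩⟩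
  have : Nontrivial (Fin n) := Fin.nontrivial_iff_two_le.2 (by omega)
  obtain ⟨H, hH⟩ : ∃ H, H = (⊤ : SimpleGraph (Fin n)).deleteEdges (pairing n ∪
      {s((⟨n - 2, by omega⟩ : Fin n), (⟨n - 1, by omega⟩ : Fin n))}) := ⟨_, rfl⟩
  rw [← hH]
  have hdeg := degree_deleteEdges_pairing_union hn2 ho hH
  let c : Fin n := ⟨n - 2, by omega⟩
  have hdegc : H.degree c + 3 = n := by simpa [c] using hdeg c
  have hdeg2 : ∀ v, v ≠ c → H.degree v + 2 = n := by
    intro v hv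
    have h : v.val ≠ n - 2 := fun h => hv (Fin.ext h)
    simpa [h] using hdeg v
  have hdeg3 : ∀ v, H.degree v + 3 = n ∨ H.degree v + 2 = n := by
    intro v
    by_cases h : v = c
    · exact Or.inl (h ▸ hdegc)
    · exact Or.inr (hdeg2 v h)
  have hconn : H.Connected := connected_of_le_degree_add_degree fun u v _ => by
    have := hdeg3 u
    have := hdeg3 v
    rw [Fintype.card_fin]
    omega
  refine isExtremal_iff (Fintype.card_fin n) hconn
    (starMinorFree_of_degree_lt (by simp [hn]) fun v => by have := hdeg3 v; omega) ?_ G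
  intro G' h1 h2 hq
  have hcast : ((t - 1 : ℕ) : ℝ) = n - 2 := by
    rw [hn, Nat.cast_sub (by omega)]
    push_cast
    ring
  obtain ⟨δ', hδ'⟩ : ∃ δ', qIndex H = 2 * ((n : ℝ) - 2) - δ' :=
    ⟨2 * ((n : ℝ) - 2) - qIndex H, by ring⟩
  obtain ⟨δ, hδ⟩ : ∃ δ, qIndex G' = 2 * ((n : ℝ) - 2) - δ :=
    ⟨2 * ((n : ℝ) - 2) - qIndex G', by ring⟩
  have hDG : ∀ v, G'.degree v ≤ t - 1 := fun v => by
    have := h2.degree_lt v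
    omega
  have hδ0 : 0 ≤ δ := by
    have := qIndex_le_of_degree_le h1 hDG
    rw [hcast] at this
    linarith
  have hle : δ ≤ δ' := by linarith
  have hnδ' : n * δ' ≤ 2 := by
    have h := two_mul_sum_degree_le H
    have h3 : ∑ v, 2 * (H.degree v : ℝ) =
        ∑ v : Fin n, (2 * ((n : ℝ) - 2) - if v = c then 2 else 0) := by
      refine Finset.sum_congr rfl fun v _ => ?_
      split_ifs with hv
      · have : ((H.degree v + 3 : ℕ) : ℝ) = n := by rw [hv, hdegc]
        push_cast at this
        linarith
      · have : ((H.degree v + 2 : ℕ) : ℝ) = n := by rw [hdeg2 v hv]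
        push_cast at this
        linarith
    rw [h3, Finset.sum_sub_distrib, Finset.sum_ite_eq' Finset.univ c, if_pos (Finset.mem_univ c),
      Finset.sum_const, Finset.card_univ, Fintype.card_fin, nsmul_eq_mul, hδ'] at h
    linarith
  have e' := qIndex_equation hconn (a := 2) (w := c) (δ := δ') (by simpa using hdeg2)
    (by simpa using hdegc) (by simpa using hδ')
  rw [Fintype.card_fin] at e'
  have hnδ : n * δ ≤ 2 := le_trans (mul_le_mul_of_nonneg_left hle (by positivity)) hnδ'
  have hδ2 : δ < 2 := by nlinarith
  have hδn : n * δ - δ ^ 2 < 2 := by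
    rcases hδ0.eq_or_lt with h | h
    · rw [← h]
      norm_num
    · have := pow_pos h 2
      linarith
  obtain ⟨v, hv, hNv⟩ := exists_degree_eq_of_qIndex_eq h1 hDG (δ := δ) (by rw [hcast, hδ]) hδ2
    (by rw [hcast]; linarith)
  have hv1 : G'ᶜ.degree v = 1 := by
    rw [degree_compl, Fintype.card_fin]
    omega
  obtain ⟨w, hw, huniq⟩ := degree_eq_one_iff_existsUnique_adj.1 hv1
  have hrest : ∀ u, u ≠ w → G'.degree u + 2 = n := by
    intro u hu
    have : G'.degree u = t - 1 := by
      by_cases huv : u = v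
      · rw [huv, hv]
      by_cases hadj : G'.Adj v u
      · exact hNv u hadj
      · exact absurd (huniq u ⟨Ne.symm huv, hadj⟩) hu
    omega
  -- by the handshake lemma the number `a` of non-neighbours of `w` is even
  have heven : Even (G'.degree w) := by
    have h3 := G'.sum_degrees_eq_twice_card_edges
    rw [← Finset.add_sum_erase _ _ (Finset.mem_univ w),
      Finset.sum_congr rfl (g := fun _ => n - 2) (fun u hu => by
        have := hrest u (Finset.ne_of_mem_erase hu)
        omega),
      Finset.sum_const, Finset.card_erase_of_mem (Finset.mem_univ w), Finset.card_univ,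
      Fintype.card_fin, smul_eq_mul] at h3
    have h4 : Even ((n - 1) * (n - 2)) := by
      obtain ⟨k, hk⟩ := ho
      exact Even.mul_right ⟨k, by omega⟩ _
    have h5 : Even (G'.degree w + (n - 1) * (n - 2)) := h3 ▸ even_two_mul _
    exact (Nat.even_add.1 h5).2 h4
  have hpos : 0 < G'.degree w := h1.preconnected.degree_pos_of_nontrivial w
  have hltw := h2.degree_lt w
  obtain ⟨a, ha⟩ : ∃ a, G'.degree w + (a + 1) = n := ⟨n - G'.degree w - 1, by omega⟩
  have ha2 : 2 ≤ a ∧ a + 3 ≤ n := by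
    obtain ⟨k, hk⟩ := ho
    obtain ⟨l, hl⟩ := heven
    omega
  rcases ha2.1.eq_or_lt with rfl | hlt
  · rw [hH]
    exact nonempty_iso_of_degree_of_odd hn2 ha hrest
  · have e := qIndex_equation h1 (a := a) (w := w) (δ := δ) (by simpa using hrest)
      (by simpa using ha) (by simpa using hδ)
    rw [Fintype.card_fin] at e
    have h3 : (a : ℝ) + 3 ≤ n := by exact_mod_cast ha2.2
    refine (false_of_star_equations hn5' hδ0 hle hnδ' ?_ e (by exact_mod_cast hlt)
      (by linarith)).elim
    push_cast at e'
    linarith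

end SmallOrder

/-! ### A complete graph with one subdivided edge: the core -/

section Core

variable {V : Type*} {G : SimpleGraph V}

/-- `K` induces in `G` a complete graph without the edge `ab`, and the only edges leaving `K` are
`aa'` and `bb'`. -/
structure IsCore (G : SimpleGraph V) (K : Finset V) (a b a' b' : V) : Prop where
  a_mem : a ∈ K
  b_mem : b ∈ K
  ne : a ≠ b
  a'_notMem : a' ∉ K
  b'_notMem : b' ∉ K
  ne' : a' ≠ b'
  adj_iff : ∀ x ∈ K, ∀ y ∈ K, G.Adj x y ↔ x ≠ y ∧ s(x, y) ≠ s(a, b)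
  adj_out_iff : ∀ x ∈ K, ∀ y ∉ K, G.Adj x y ↔ (x = a ∧ y = a') ∨ (x = b ∧ y = b')

theorem IsCore.symm {K : Finset V} {a b a' b' : V} (h : IsCore G K a b a' b') :
    IsCore G K b a b' a' where
  a_mem := h.b_mem
  b_mem := h.a_mem
  ne := h.ne.symm
  a'_notMem := h.b'_notMem
  b'_notMem := h.a'_notMem
  ne' := h.ne'.symm
  adj_iff x hx y hy := by rw [h.adj_iff x hx y hy, Sym2.eq_swap (a := b)]
  adj_out_iff x hx y hy := by rw [h.adj_out_iff x hx y hy, or_comm]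

open Classical in
/-- The eigenvalue equations on the core, where the two outside neighbours have positive
entries. -/
theorem IsCore.qIndex_bound [Fintype V] (hG : G.Connected) {K : Finset V} {a b a' b' : V}
    (h : IsCore G K a b a' b') {t : ℕ} (ht : 3 ≤ t) (hK : K.card = t) {δ : ℝ}
    (hq : qIndex G = 2 * (t - 1) - δ) : δ < 2 ∧ (t + 1) * δ - δ ^ 2 < 2 := by
  obtain ⟨x, hx⟩ := exists_isPerronVector hG
  let I := (K.erase a).erase b
  have hI : ∀ u, u ∈ I ↔ u ≠ b ∧ u ≠ a ∧ u ∈ K := by simp [I]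
  have hbK : b ∈ K.erase a := Finset.mem_erase.2 ⟨h.ne.symm, h.b_mem⟩
  have hIcard : I.card + 2 = t := by
    have h1 := Finset.card_erase_add_one h.a_mem
    have h2 := Finset.card_erase_add_one hbK
    change ((K.erase a).erase b).card + 2 = t
    omega
  have hIcard' : (I.card : ℝ) = t - 2 := by
    have : ((I.card + 2 : ℕ) : ℝ) = t := by rw [hIcard]
    push_cast at this
    linarith
  have hKsum : ∑ u ∈ K, x u = x a + x b + ∑ u ∈ I, x u := by
    rw [← Finset.add_sum_erase _ _ h.a_mem, ← Finset.add_sum_erase _ _ hbK, add_assoc]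
  have hinner : ∀ u ∈ I, qIndex G * x u = (t - 2) * x u + ∑ u ∈ K, x u := by
    intro u hu
    obtain ⟨hub, hua, huK⟩ := (hI u).1 hu
    have hN : G.neighborFinset u = K.erase u := by
      ext y
      rw [mem_neighborFinset, Finset.mem_erase]
      by_cases hy : y ∈ K
      · rw [h.adj_iff u huK y hy]
        have : s(u, y) ≠ s(a, b) := by
          rw [Ne, Sym2.eq_iff]
          tauto
        have : u ≠ y ↔ y ≠ u := ne_comm
        tauto
      · rw [h.adj_out_iff u huK y hy]
        tauto
    have h1 := hx.sum_neighbors u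
    have hd : (G.degree u : ℝ) = t - 1 := by
      have h3 := Finset.card_erase_add_one huK
      rw [← hN, hK, card_neighborFinset_eq_degree] at h3
      have : ((G.degree u + 1 : ℕ) : ℝ) = t := by rw [h3]
      push_cast at this
      linarith
    rw [hd, hN] at h1
    rw [← Finset.add_sum_erase _ _ huK]
    linarith
  have hend : ∀ {a b a' b' : V}, IsCore G K a b a' b' → (∀ u, u ∈ I ↔ u ≠ b ∧ u ≠ a ∧ u ∈ K) →
      qIndex G * x a = (t - 1) * x a + (x a' + ∑ u ∈ I, x u) := by
    intro a b a' b' h hI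
    have ha'I : a' ∉ I := fun h' => h.a'_notMem ((hI a').1 h').2.2
    have hN : G.neighborFinset a = insert a' I := by
      ext y
      rw [mem_neighborFinset, Finset.mem_insert, hI]
      by_cases hy : y ∈ K
      · rw [h.adj_iff a h.a_mem y hy, Ne, Ne, Sym2.eq_iff]
        have h1 : y ≠ a' := fun h' => h.a'_notMem (h' ▸ hy)
        have h2 := h.ne
        have : a = y ↔ y = a := eq_comm
        tauto
      · rw [h.adj_out_iff a h.a_mem y hy]
        have := h.ne
        tauto
    have h1 := hx.sum_neighbors a
    have hd : (G.degree a : ℝ) = t - 1 := by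
      rw [← card_neighborFinset_eq_degree, hN, Finset.card_insert_of_notMem ha'I]
      push_cast
      linarith
    rwa [hd, hN, Finset.sum_insert ha'I] at h1
  have ha := hend h hI
  have hb := hend h.symm fun u => by
    rw [hI]
    tauto
  have hIsum : qIndex G * ∑ u ∈ I, x u =
      (t - 2) * ∑ u ∈ I, x u + (t - 2) * (x a + x b + ∑ u ∈ I, x u) := by
    rw [Finset.mul_sum, Finset.sum_congr rfl hinner, Finset.sum_add_distrib, ← Finset.mul_sum,
      Finset.sum_const, hKsum, nsmul_eq_mul, hIcard']
  have hA : 0 < ∑ u ∈ I, x u :=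
    Finset.sum_pos (fun u _ => hx.pos u) (Finset.card_pos.1 (by omega))
  set A := ∑ u ∈ I, x u
  have ht' : (3 : ℝ) ≤ t := by exact_mod_cast ht
  have hB : 0 < x a + x b := add_pos (hx.pos a) (hx.pos b)
  have hP : 0 < x a' + x b' := add_pos (hx.pos a') (hx.pos b')
  rw [hq] at ha hb hIsum
  have e1 : (2 - δ) * A = (t - 2) * (x a + x b) := by linarith
  have e2 : (t - 1 - δ) * (x a + x b) = 2 * A + (x a' + x b') := by linarith
  have hδ : 0 < 2 - δ := by
    refine pos_of_mul_pos_left ?_ hA.le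
    rw [e1]
    exact mul_pos (by linarith) hB
  refine ⟨by linarith, ?_⟩
  have e3 : (t - 1 - δ) * (2 - δ) * A = (t - 2) * (2 * A) + (t - 2) * (x a' + x b') := by
    linear_combination (t - 1 - δ) * e1 + (t - 2) * e2
  have e4 : 0 < (t - 2) * (x a' + x b') := mul_pos (by linarith) hP
  have e5 : 0 < (2 - ((t + 1) * δ - δ ^ 2)) * A := by linarith
  have := pos_of_mul_pos_left e5 hA.le
  linarith

open Classical in
/-- In a connected `K_{1,t}`-minor free graph with at least `t + 2` vertices, the closed
neighbourhood of a vertex whose members all have degree `t - 1` is a core. Contracting suitable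
edges shows that a vertex of it has at most one outside neighbour, and therefore misses at most one
vertex inside. -/
theorem exists_isCore [Fintype V] (hG : G.Connected) {t : ℕ} (ht : 3 ≤ t)
    (hV : t + 2 ≤ Fintype.card V) (hf : StarMinorFree t G) {v : V} (hv : G.degree v = t - 1)
    (hN : ∀ u, G.Adj v u → G.degree u = t - 1) :
    ∃ K : Finset V, K.card = t ∧ ∃ a b a' b', IsCore G K a b a' b' := by
  rw [starMinorFree_iff] at hf
  let K := insert v (G.neighborFinset v)
  have hmemK : ∀ u, u ∈ K ↔ u = v ∨ G.Adj v u := by simp [K]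
  have hvK : v ∈ K := (hmemK v).2 (Or.inl rfl)
  have hKcard : K.card = t := by
    have : v ∉ G.neighborFinset v := by simp
    rw [Finset.card_insert_of_notMem this, card_neighborFinset_eq_degree, hv]
    omega
  have hdeg : ∀ u ∈ K, G.degree u = t - 1 := by
    intro u hu
    rcases (hmemK u).1 hu with rfl | h
    · exact hv
    · exact hN u h
  clear_value K
  have hpair : ∀ {c d : V}, c ∈ K → d ∈ K → c ≠ d → ((K.erase c).erase d).card + 2 = t := by
    intro c d hc hd hcd
    have h1 := Finset.card_erase_add_one hc
    have h2 := Finset.card_erase_add_one (Finset.mem_erase.2 ⟨hcd.symm, hd⟩)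
    omega
  let out : V → Finset V := fun u => G.neighborFinset u \ K
  let miss : V → Finset V := fun u => K.erase u \ G.neighborFinset u
  have hmemO : ∀ u y, y ∈ out u ↔ G.Adj u y ∧ y ∉ K := by simp [out]
  have hmemM : ∀ u y, y ∈ miss u ↔ (y ≠ u ∧ y ∈ K) ∧ ¬ G.Adj u y := by simp [miss]
  have hcards : ∀ u ∈ K, (out u).card = (miss u).card := by
    intro u hu
    have h1 := Finset.card_sdiff_add_card_inter (G.neighborFinset u) K
    have h2 := Finset.card_sdiff_add_card_inter (K.erase u) (G.neighborFinset u)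
    have h3 : G.neighborFinset u ∩ K = K.erase u ∩ G.neighborFinset u := by
      ext y
      simp only [Finset.mem_inter, mem_neighborFinset, Finset.mem_erase]
      exact ⟨fun h => ⟨⟨h.1.ne', h.2⟩, h.1⟩, fun h => ⟨h.2, h.1.2⟩⟩
    have h4 := Finset.card_erase_add_one hu
    rw [card_neighborFinset_eq_degree, hdeg u hu] at h1
    rw [h3] at h1
    change (G.neighborFinset u \ K).card = (K.erase u \ G.neighborFinset u).card
    omega
  clear_value out miss
  have hout1 : ∀ u ∈ K, (out u).card ≤ 1 := by
    intro u hu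
    rcases (hmemK u).1 hu with rfl | huv
    · rw [Finset.card_eq_zero.2]
      · exact Nat.zero_le _
      · rw [Finset.eq_empty_iff_forall_notMem]
        intro y hy
        have := (hmemO _ _).1 hy
        exact this.2 ((hmemK y).2 (Or.inr this.1))
    · have h1 := hf {v, u} (induce_pair_connected huv) ((K.erase v).erase u ∪ out u) (by
        intro y hy
        rcases Finset.mem_union.1 hy with hy | hy
        · obtain ⟨h1, h2, h3⟩ : y ≠ u ∧ y ≠ v ∧ y ∈ K := by simpa using hy
          exact ⟨by simp [h1, h2], v, by simp, ((hmemK y).1 h3).resolve_left h2⟩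
        · obtain ⟨h1, h2⟩ := (hmemO u y).1 hy
          refine ⟨?_, u, by simp, h1⟩
          rintro (rfl | rfl)
          · exact h2 hvK
          · exact h2 hu)
      rw [Finset.card_union_of_disjoint] at h1
      · have := hpair hvK hu (G.ne_of_adj huv)
        omega
      · rw [Finset.disjoint_left]
        intro y hy hy'
        exact ((hmemO u y).1 hy').2 (Finset.mem_of_mem_erase (Finset.mem_of_mem_erase hy))
  obtain ⟨z, hz⟩ : ∃ z, z ∉ K := by
    by_contra! hcon
    rw [Finset.eq_univ_iff_forall.2 hcon, Finset.card_univ] at hKcard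
    omega
  obtain ⟨a, a', haK, ha'K, haa'⟩ := exists_adj_of_connected hG (· ∈ K) hvK hz
  have hsingle : ∀ s : Finset V, s.card = 1 → ∀ y ∈ s, s = {y} := by
    intro s hs y hy
    obtain ⟨w, rfl⟩ := Finset.card_eq_one.1 hs
    rw [Finset.mem_singleton.1 hy]
  have hOa1 : (out a).card = 1 := le_antisymm (hout1 a haK)
    (Finset.card_pos.2 ⟨a', (hmemO a a').2 ⟨haa', ha'K⟩⟩)
  have hOa := hsingle _ hOa1 a' ((hmemO a a').2 ⟨haa', ha'K⟩)
  obtain ⟨b, hMa⟩ := Finset.card_eq_one.1 ((hcards a haK).symm.trans hOa1)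
  obtain ⟨⟨hba, hbK⟩, hnab⟩ := (hmemM a b).1 (hMa ▸ Finset.mem_singleton_self b)
  have haMb : a ∈ miss b := (hmemM b a).2 ⟨⟨hba.symm, haK⟩, fun h => hnab h.symm⟩
  have hMb1 : (miss b).card = 1 := le_antisymm ((hcards b hbK) ▸ hout1 b hbK)
    (Finset.card_pos.2 ⟨a, haMb⟩)
  have hMb := hsingle _ hMb1 a haMb
  obtain ⟨b', hOb⟩ := Finset.card_eq_one.1 ((hcards b hbK).trans hMb1)
  obtain ⟨hbb', hb'K⟩ := (hmemO b b').1 (hOb ▸ Finset.mem_singleton_self b')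
  have hadja : ∀ y ∈ K, y ≠ a → y ≠ b → G.Adj a y := by
    intro y hy h1 h2
    by_contra h
    have := (hmemM a y).2 ⟨⟨h1, hy⟩, h⟩
    rw [hMa] at this
    exact h2 (Finset.mem_singleton.1 this)
  have hadjb : ∀ y ∈ K, y ≠ a → y ≠ b → G.Adj b y := by
    intro y hy h1 h2
    by_contra h
    have := (hmemM b y).2 ⟨⟨h2, hy⟩, h⟩
    rw [hMb] at this
    exact h1 (Finset.mem_singleton.1 this)
  -- contracting `ac` (or `bc`): a third vertex has no outside neighbour of its own
  have hthird : ∀ {a b a' : V}, a ∈ K → a' ∉ K → G.Adj a a' → b ∈ K →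
      (∀ y ∈ K, y ≠ a → y ≠ b → G.Adj a y) → (∀ y ∈ K, y ≠ a → y ≠ b → G.Adj b y) →
      ∀ c ∈ K, c ≠ a → c ≠ b → ∀ y ∈ out c, y = a' := by
    intro a b a' haK ha'K haa' hbK hadja hadjb c hc hca hcb y hy
    by_contra hya
    obtain ⟨hcy, hyK⟩ := (hmemO c y).1 hy
    have h1 := hf {a, c} (induce_pair_connected (hadja c hc hca hcb))
      ((K.erase a).erase c ∪ {a', y}) (by
        intro w hw
        rcases Finset.mem_union.1 hw with hw | hw
        · obtain ⟨h1, h2, h3⟩ : w ≠ c ∧ w ≠ a ∧ w ∈ K := by simpa using hw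
          refine ⟨by simp [h1, h2], ?_⟩
          by_cases hwb : w = b
          · exact ⟨c, by simp, hwb ▸ (hadjb c hc hca hcb).symm⟩
          · exact ⟨a, by simp, hadja w h3 h2 hwb⟩
        · rcases Finset.mem_insert.1 hw with rfl | hw
          · refine ⟨?_, a, by simp, haa'⟩
            rintro (rfl | rfl)
            · exact ha'K haK
            · exact ha'K hc
          · obtain rfl := Finset.mem_singleton.1 hw
            refine ⟨?_, c, by simp, hcy⟩
            rintro (rfl | rfl)
            · exact hyK haK
            · exact hyK hc)
    rw [Finset.card_union_of_disjoint, Finset.card_pair (Ne.symm hya)] at h1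
    · have := hpair haK hc hca.symm
      omega
    · rw [Finset.disjoint_left]
      intro w hw hw'
      have hwK := Finset.mem_of_mem_erase (Finset.mem_of_mem_erase hw)
      rcases Finset.mem_insert.1 hw' with rfl | hw'
      · exact ha'K hwK
      · exact hyK (Finset.mem_singleton.1 hw' ▸ hwK)
  have hthirda := hthird haK ha'K haa' hbK hadja hadjb
  have hthirdb := hthird hbK hb'K hbb' haK (fun y hy h1 h2 => hadjb y hy h2 h1)
    (fun y hy h1 h2 => hadja y hy h2 h1)
  -- if both ends had the same outside neighbour `a'`, contracting `aa'` would give a large star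
  have hne' : a' ≠ b' := by
    intro hab'
    have hout : ∀ c ∈ K, ∀ y ∈ out c, y = a' := by
      intro c hc y hy
      by_cases hca : c = a
      · rw [hca, hOa] at hy
        exact Finset.mem_singleton.1 hy
      by_cases hcb : c = b
      · rw [hcb, hOb] at hy
        rw [hab']
        exact Finset.mem_singleton.1 hy
      · exact hthirda c hc hca hcb y hy
    obtain ⟨w, hw⟩ : ∃ w, w ∉ insert a' K := by
      by_contra! hcon
      have h1 := Finset.card_insert_le a' K
      rw [Finset.eq_univ_iff_forall.2 hcon, Finset.card_univ] at h1
      omega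
    obtain ⟨x, y, hx, hy, hxy⟩ := exists_adj_of_connected hG (· ∈ insert a' K)
      (Finset.mem_insert_of_mem hvK) hw
    rw [Finset.mem_insert, not_or] at hy
    have hxa : x = a' := by
      rcases Finset.mem_insert.1 hx with h | h
      · exact h
      · exact absurd (hout x h y ((hmemO x y).2 ⟨hxy, hy.2⟩)) hy.1
    subst hxa
    have h1 := hf {a, x} (induce_pair_connected haa') (insert y (K.erase a)) (by
      intro u hu
      rcases Finset.mem_insert.1 hu with rfl | hu
      · refine ⟨?_, x, by simp, hxy⟩
        rintro (rfl | rfl)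
        · exact hy.2 haK
        · exact hy.1 rfl
      · obtain ⟨hua, huK⟩ := Finset.mem_erase.1 hu
        refine ⟨?_, ?_⟩
        · rintro (rfl | rfl)
          · exact hua rfl
          · exact ha'K huK
        · by_cases hub : u = b
          · exact ⟨x, by simp, hub ▸ hab' ▸ hbb'.symm⟩
          · exact ⟨a, by simp, hadja u huK hua hub⟩)
    rw [Finset.card_insert_of_notMem (fun h => hy.2 (Finset.mem_of_mem_erase h)),
      Finset.card_erase_add_one haK] at h1
    omega
  have houtc : ∀ c ∈ K, c ≠ a → c ≠ b → out c = ∅ := by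
    intro c hc hca hcb
    rw [Finset.eq_empty_iff_forall_notMem]
    intro y hy
    exact hne' ((hthirda c hc hca hcb y hy).symm.trans (hthirdb c hc hcb hca y hy))
  refine ⟨K, hKcard, a, b, a', b', haK, hbK, hba.symm, ha'K, hb'K, hne', ?_, ?_⟩
  · intro x hx y hy
    rw [Ne, Ne, Sym2.eq_iff]
    constructor
    · intro h
      refine ⟨G.ne_of_adj h, ?_⟩
      rintro (⟨rfl, rfl⟩ | ⟨rfl, rfl⟩)
      · exact hnab h
      · exact hnab h.symm
    · rintro ⟨hxy, h⟩
      by_cases hxa : x = a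
      · exact hxa ▸ hadja y hy (fun h' => hxy (hxa.trans h'.symm)) (fun h' => h (Or.inl ⟨hxa, h'⟩))
      by_cases hxb : x = b
      · exact hxb ▸ hadjb y hy (fun h' => h (Or.inr ⟨hxb, h'⟩)) (fun h' => hxy (hxb.trans h'.symm))
      by_contra hn
      have h1 := hcards x hx
      rw [houtc x hx hxa hxb, Finset.card_empty] at h1
      have h2 := (hmemM x y).2 ⟨⟨Ne.symm hxy, hy⟩, hn⟩
      rw [Finset.card_eq_zero.1 h1.symm] at h2
      exact Finset.notMem_empty _ h2
  · intro x hx y hy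
    constructor
    · intro h
      have hyx := (hmemO x y).2 ⟨h, hy⟩
      by_cases hxa : x = a
      · rw [hxa, hOa] at hyx
        exact Or.inl ⟨hxa, Finset.mem_singleton.1 hyx⟩
      by_cases hxb : x = b
      · rw [hxb, hOb] at hyx
        exact Or.inr ⟨hxb, Finset.mem_singleton.1 hyx⟩
      rw [houtc x hx hxa hxb] at hyx
      exact absurd hyx (Finset.notMem_empty _)
    · rintro (⟨rfl, rfl⟩ | ⟨rfl, rfl⟩)
      · exact haa'
      · exact hbb'

end Core

/-! ### The vertices outside the core form paths -/

section Outside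

variable {V : Type*} {G : SimpleGraph V}

/-- The graph formed by the edges of `G` that avoid `K`. -/
def outside (G : SimpleGraph V) (K : Finset V) : SimpleGraph V where
  Adj x y := G.Adj x y ∧ x ∉ K ∧ y ∉ K
  symm := ⟨fun _ _ h => ⟨h.1.symm, h.2.2, h.2.1⟩⟩
  loopless := ⟨fun _ h => G.irrefl h.1⟩

theorem outside_reachable_notMem {K : Finset V} {x y : V} (h : (outside G K).Reachable x y)
    (hx : x ∉ K) : y ∉ K := by
  obtain ⟨p⟩ := h
  induction p with
  | nil => exact hx
  | cons h p ih => exact ih h.2.2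

theorem exists_adj_dist_lt {x y : V} (h : G.Reachable x y) (hne : y ≠ x) :
    ∃ z, G.Adj y z ∧ G.Reachable x z ∧ G.dist x z < G.dist x y := by
  obtain ⟨p, hp⟩ := h.symm.exists_walk_length_eq_dist
  cases p with
  | nil => exact absurd rfl hne
  | @cons _ z _ hyz p =>
    refine ⟨z, hyz, ⟨p.reverse⟩, ?_⟩
    have := dist_le p
    rw [Walk.length_cons] at hp
    rw [dist_comm, dist_comm (u := x)]
    omega

/-- Contract the ball of radius `i` around `a'` outside the core together with `a`: in total at most
one new vertex can be adjacent to the ball, and none if the ball contains `b'`. -/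
theorem IsCore.growth {K : Finset V} {a b a' b' : V} (h : IsCore G K a b a' b') {t : ℕ}
    (hK : K.card = t) (hf : StarMinorFree t G) {i : ℕ} {B : Set V}
    (hB : ∀ y, y ∈ B ↔ (outside G K).Reachable a' y ∧ (outside G K).dist a' y ≤ i) :
    (∀ y z, y ∉ B → z ∉ B → (∃ x ∈ B, (outside G K).Adj x y) → (∃ x ∈ B, (outside G K).Adj x z) →
      y = z) ∧ (b' ∈ B → ∀ y, y ∉ B → ¬ ∃ x ∈ B, (outside G K).Adj x y) := by
  classical
  rw [starMinorFree_iff] at hf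
  have hBK : ∀ y ∈ B, y ∉ K := fun y hy => outside_reachable_notMem ((hB y).1 hy).1 h.a'_notMem
  have ha'B : a' ∈ B := (hB a').2 ⟨Reachable.refl _, by simp⟩
  have haa' : G.Adj a a' := (h.adj_out_iff a h.a_mem a' h.a'_notMem).2 (Or.inl ⟨rfl, rfl⟩)
  have hbb' : G.Adj b b' := (h.adj_out_iff b h.b_mem b' h.b'_notMem).2 (Or.inr ⟨rfl, rfl⟩)
  have hconn : (G.induce (insert a B)).Connected := by
    refine induce_connected_of_rank (r := a) (Set.mem_insert _ _)
      (fun y => if y ∈ K then 0 else (outside G K).dist a' y + 1) ?_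
    intro x hx hxa
    have hxB : x ∈ B := hx.resolve_left hxa
    have hxK := hBK x hxB
    by_cases hxa' : x = a'
    · subst hxa'
      exact ⟨a, Set.mem_insert _ _, haa'.symm, by simp [h.a_mem, hxK]⟩
    · obtain ⟨z, hxz, hz, hlt⟩ := exists_adj_dist_lt ((hB x).1 hxB).1 hxa'
      have hzB : z ∈ B := (hB z).2 ⟨hz, hlt.le.trans ((hB x).1 hxB).2⟩
      exact ⟨z, Set.mem_insert_of_mem _ hzB, hxz.1, by simp [hBK z hzB, hxK, hlt]⟩
  have hadj : ∀ y ∈ K, y ≠ a → y ≠ b → G.Adj a y := by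
    intro y hy h1 h2
    rw [h.adj_iff a h.a_mem y hy, Ne, Ne, Sym2.eq_iff]
    have := h.ne
    have : a = y ↔ y = a := eq_comm
    tauto
  have hold : ∀ y ∈ K, y ≠ a → y ∉ insert a B := by
    rintro y hy hya (h1 | h1)
    · exact hya h1
    · exact hBK y h1 hy
  have hnew : ∀ y, y ∉ B → (∃ x ∈ B, (outside G K).Adj x y) →
      y ∉ K ∧ y ∉ insert a B ∧ ∃ x ∈ insert a B, G.Adj x y := by
    rintro y hy ⟨x, hx, hxy⟩
    refine ⟨hxy.2.2, ?_, x, Set.mem_insert_of_mem _ hx, hxy.1⟩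
    rintro (rfl | h1)
    · exact hxy.2.2 h.a_mem
    · exact hy h1
  constructor
  · intro y z hy hz hxy hxz
    by_contra hne
    obtain ⟨hyK, hyS, hyadj⟩ := hnew y hy hxy
    obtain ⟨hzK, hzS, hzadj⟩ := hnew z hz hxz
    have h1 := hf _ hconn ((K.erase a).erase b ∪ {y, z}) (by
      intro w hw
      rcases Finset.mem_union.1 hw with hw | hw
      · obtain ⟨h1, h2, h3⟩ : w ≠ b ∧ w ≠ a ∧ w ∈ K := by simpa using hw
        exact ⟨hold w h3 h2, a, Set.mem_insert _ _, hadj w h3 h2 h1⟩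
      · rcases Finset.mem_insert.1 hw with rfl | hw
        · exact ⟨hyS, hyadj⟩
        · obtain rfl := Finset.mem_singleton.1 hw
          exact ⟨hzS, hzadj⟩)
    rw [Finset.card_union_of_disjoint, Finset.card_pair hne] at h1
    · have h2 := Finset.card_erase_add_one h.a_mem
      have h3 := Finset.card_erase_add_one (Finset.mem_erase.2 ⟨h.ne.symm, h.b_mem⟩)
      omega
    · rw [Finset.disjoint_left]
      intro w hw hw'
      have hwK := Finset.mem_of_mem_erase (Finset.mem_of_mem_erase hw)
      rcases Finset.mem_insert.1 hw' with rfl | hw'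
      · exact hyK hwK
      · exact hzK (Finset.mem_singleton.1 hw' ▸ hwK)
  · intro hb'B y hy hxy
    obtain ⟨hyK, hyS, hyadj⟩ := hnew y hy hxy
    have h1 := hf _ hconn (insert y (K.erase a)) (by
      intro w hw
      rcases Finset.mem_insert.1 hw with rfl | hw
      · exact ⟨hyS, hyadj⟩
      · obtain ⟨hwa, hwK⟩ := Finset.mem_erase.1 hw
        refine ⟨hold w hwK hwa, ?_⟩
        by_cases hwb : w = b
        · exact ⟨b', Set.mem_insert_of_mem _ hb'B, hwb ▸ hbb'.symm⟩
        · exact ⟨a, Set.mem_insert _ _, hadj w hwK hwa hwb⟩)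
    rw [Finset.card_insert_of_notMem (fun h' => hyK (Finset.mem_of_mem_erase h')),
      Finset.card_erase_add_one h.a_mem] at h1
    omega

theorem IsCore.dist_injective {K : Finset V} {a b a' b' : V} (h : IsCore G K a b a' b') {t : ℕ}
    (hK : K.card = t) (hf : StarMinorFree t G) {x y : V} (hx : (outside G K).Reachable a' x)
    (hy : (outside G K).Reachable a' y)
    (hxy : (outside G K).dist a' x = (outside G K).dist a' y) : x = y := by
  by_cases hxa : x = a'
  · subst hxa
    rw [dist_self, eq_comm, hy.dist_eq_zero_iff] at hxy
    exact hxy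
  by_cases hya : y = a'
  · subst hya
    rw [dist_self, hx.dist_eq_zero_iff] at hxy
    exact hxy.symm
  obtain ⟨u, hxu, hu, hlu⟩ := exists_adj_dist_lt hx hxa
  obtain ⟨w, hyw, hw, hlw⟩ := exists_adj_dist_lt hy hya
  refine (h.growth hK hf (i := (outside G K).dist a' x - 1)
    (B := {z | (outside G K).Reachable a' z ∧ (outside G K).dist a' z ≤
      (outside G K).dist a' x - 1}) (fun z => Iff.rfl)).1 x y ?_ ?_ ⟨u, ⟨hu, ?_⟩, hxu.symm⟩
      ⟨w, ⟨hw, ?_⟩, hyw.symm⟩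
  · rintro ⟨-, h1⟩
    omega
  · rintro ⟨-, h1⟩
    omega
  · omega
  · omega

theorem IsCore.dist_le_dist {K : Finset V} {a b a' b' : V} (h : IsCore G K a b a' b') {t : ℕ}
    (hK : K.card = t) (hf : StarMinorFree t G) {y : V} (hb' : (outside G K).Reachable a' b')
    (hy : (outside G K).Reachable a' y) :
    (outside G K).dist a' y ≤ (outside G K).dist a' b' := by
  by_contra! hlt
  have hya : y ≠ a' := by
    rintro rfl
    rw [dist_self] at hlt
    omega
  obtain ⟨u, hyu, hu, hlu⟩ := exists_adj_dist_lt hy hya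
  refine (h.growth hK hf (i := (outside G K).dist a' y - 1)
    (B := {z | (outside G K).Reachable a' z ∧ (outside G K).dist a' z ≤
      (outside G K).dist a' y - 1}) (fun z => Iff.rfl)).2 ⟨hb', by omega⟩ y ?_
      ⟨u, ⟨hu, by omega⟩, hyu.symm⟩
  rintro ⟨-, h1⟩
  omega

/-- The vertices outside the core can be placed on a line, starting at `a'` and ending at `b'`, so
that adjacent vertices are one unit apart. The vertices not reachable from `a'` are placed by their
distance from `b'`, far away from the others. -/
theorem IsCore.exists_key [Fintype V] (hG : G.Connected) {K : Finset V} {a b a' b' : V}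
    (h : IsCore G K a b a' b') {t : ℕ} (hK : K.card = t) (hf : StarMinorFree t G) :
    ∃ key : V → ℤ, (∀ x ∉ K, ∀ y ∉ K, key x = key y → x = y) ∧
      (∀ x ∉ K, ∀ y ∉ K, G.Adj x y → key x = key y + 1 ∨ key y = key x + 1) ∧
      ∀ y ∉ K, key a' ≤ key y ∧ key y ≤ key b' := by
  classical
  set R := outside G K with hR
  obtain ⟨N, hNa, hNb⟩ : ∃ N : ℕ, (∀ y, R.dist a' y ≤ N) ∧ ∀ y, R.dist b' y ≤ N := by
    refine ⟨∑ y, R.dist a' y + ∑ y, R.dist b' y, fun y => ?_, fun y => ?_⟩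
    · have := Finset.single_le_sum (f := fun y => R.dist a' y) (fun _ _ => Nat.zero_le _)
        (Finset.mem_univ y)
      omega
    · have := Finset.single_le_sum (f := fun y => R.dist b' y) (fun _ _ => Nat.zero_le _)
        (Finset.mem_univ y)
      omega
  have hcover : ∀ y ∉ K, R.Reachable a' y ∨ R.Reachable b' y := by
    intro y hy
    by_contra hcon
    obtain ⟨x, z, hx, hz, hxz⟩ := exists_adj_of_connected hG
      (fun x => x ∈ K ∨ R.Reachable a' x ∨ R.Reachable b' x) (Or.inl h.a_mem)
      (w := y) (fun h' => h'.elim hy hcon)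
    rw [not_or] at hz
    by_cases hxK : x ∈ K
    · rcases (h.adj_out_iff x hxK z hz.1).1 hxz with ⟨-, rfl⟩ | ⟨-, rfl⟩
      · exact hz.2 (Or.inl (Reachable.refl _))
      · exact hz.2 (Or.inr (Reachable.refl _))
    · have hadj : R.Adj x z := ⟨hxz, hxK, hz.1⟩
      rcases hx.resolve_left hxK with hx | hx
      · exact hz.2 (Or.inl (hx.trans hadj.reachable))
      · exact hz.2 (Or.inr (hx.trans hadj.reachable))
  have hstep : ∀ c, (∀ x y, R.Reachable c x → R.Reachable c y → R.dist c x = R.dist c y → x = y) →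
      ∀ x y, R.Reachable c x → R.Adj x y →
        R.dist c x = R.dist c y + 1 ∨ R.dist c y = R.dist c x + 1 := by
    intro c hinj x y hx hxy
    have hne : R.dist c x ≠ R.dist c y := fun h' =>
      R.ne_of_adj hxy (hinj x y hx (hx.trans hxy.reachable) h')
    have := hxy.diff_dist_adj (u := c)
    omega
  have hinja := fun x y hx hy => h.dist_injective hK hf (x := x) (y := y) hx hy
  have hinjb := fun x y hx hy => h.symm.dist_injective hK hf (x := x) (y := y) hx hy
  let key : V → ℤ := fun y =>
    if R.Reachable a' y then (R.dist a' y : ℤ) else 2 * N + 1 - R.dist b' y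
  have hkey1 : ∀ y, R.Reachable a' y → key y = R.dist a' y := fun y hy => if_pos hy
  have hkey2 : ∀ y, ¬ R.Reachable a' y → key y = 2 * N + 1 - R.dist b' y := fun y hy => if_neg hy
  refine ⟨key, ?_, ?_, ?_⟩
  · intro x hx y hy hxy
    have h1 := hNa x
    have h2 := hNb x
    have h3 := hNa y
    have h4 := hNb y
    by_cases hxa : R.Reachable a' x <;> by_cases hya : R.Reachable a' y
    · rw [hkey1 x hxa, hkey1 y hya] at hxy
      exact hinja x y hxa hya (by exact_mod_cast hxy)
    · rw [hkey1 x hxa, hkey2 y hya] at hxy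
      omega
    · rw [hkey2 x hxa, hkey1 y hya] at hxy
      omega
    · rw [hkey2 x hxa, hkey2 y hya] at hxy
      exact hinjb x y ((hcover x hx).resolve_left hxa) ((hcover y hy).resolve_left hya)
        (by change R.dist b' x = R.dist b' y; omega)
  · intro x hx y hy hxy
    have hadj : R.Adj x y := ⟨hxy, hx, hy⟩
    by_cases hxa : R.Reachable a' x
    · have hya := hxa.trans hadj.reachable
      rw [hkey1 x hxa, hkey1 y hya]
      have := hstep a' hinja x y hxa hadj
      omega
    · have hya : ¬ R.Reachable a' y := fun h' => hxa (h'.trans hadj.symm.reachable)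
      rw [hkey2 x hxa, hkey2 y hya]
      have := hstep b' hinjb x y ((hcover x hx).resolve_left hxa) hadj
      omega
  · intro y hy
    have h3 := hNa y
    have h4 := hNb y
    have ha' : key a' = 0 := by
      rw [hkey1 a' (Reachable.refl _), SimpleGraph.dist_self]
      rfl
    rw [ha']
    by_cases hb' : R.Reachable a' b'
    · have hya : R.Reachable a' y := by
        rcases hcover y hy with h' | h'
        · exact h'
        · exact hb'.trans h'
      have := h.dist_le_dist hK hf hb' hya
      change R.dist a' y ≤ R.dist a' b' at this
      rw [hkey1 y hya, hkey1 b' hb']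
      omega
    · rw [hkey2 b' hb', SimpleGraph.dist_self]
      by_cases hya : R.Reachable a' y
      · rw [hkey1 y hya]
        omega
      · rw [hkey2 y hya]
        omega

theorem exists_equiv_fin {K : Finset V} {a b : V} (ha : a ∈ K) (hb : b ∈ K) (hab : a ≠ b) {t : ℕ}
    (hK : K.card = t) {i j : Fin t} (hij : i ≠ j) :
    ∃ e : K ≃ Fin t, e ⟨a, ha⟩ = i ∧ e ⟨b, hb⟩ = j := by
  classical
  let e₀ : K ≃ Fin t := K.equivFinOfCardEq hK
  let e₁ : K ≃ Fin t := e₀.trans (Equiv.swap (e₀ ⟨a, ha⟩) i)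
  have h1 : e₁ ⟨a, ha⟩ = i := by simp [e₁]
  have h2 : e₁ ⟨b, hb⟩ ≠ i := by
    rw [← h1]
    exact fun h => hab (congrArg Subtype.val (e₁.injective h)).symm
  refine ⟨e₁.trans (Equiv.swap (e₁ ⟨b, hb⟩) j), ?_, by simp⟩
  rw [Equiv.trans_apply, h1]
  exact Equiv.swap_apply_of_ne_of_ne h2.symm hij

/-- A connected `K_{1,t}`-minor free graph with a core is a spanning subgraph of a complete graph
with one subdivided edge. -/
theorem IsCore.exists_equiv [Fintype V] (hG : G.Connected) {K : Finset V} {a b a' b' : V}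
    (h : IsCore G K a b a' b') {t k : ℕ} (hK : K.card = t) (hf : StarMinorFree t G)
    (hV : Fintype.card V = t + k) {i j : Fin t} (hij : i ≠ j) :
    ∃ φ : V ≃ Fin t ⊕ Fin k, ∀ x y, G.Adj x y →
      (subdivideEdge (⊤ : SimpleGraph (Fin t)) i j k).Adj (φ x) (φ y) := by
  classical
  obtain ⟨key, hinj, hadj, hmin⟩ := h.exists_key hG hK hf
  obtain ⟨e, hea, heb⟩ := exists_equiv_fin h.a_mem h.b_mem h.ne hK hij
  have hcard : Kᶜ.card = k := by
    rw [Finset.card_compl, hV, hK]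
    omega
  let pos : V → ℕ := fun y => (Kᶜ.filter fun z => key z < key y).card
  have hlt : ∀ y ∉ K, pos y < k := by
    intro y hy
    rw [← hcard]
    refine Finset.card_lt_card (Finset.filter_ssubset.2 ⟨y, by simpa using hy, lt_irrefl _⟩)
  have hmono : ∀ x ∉ K, ∀ y, key x < key y → pos x < pos y := by
    intro x hx y hxy
    refine Finset.card_lt_card ((Finset.ssubset_iff_of_subset ?_).2 ⟨x, ?_, ?_⟩)
    · exact Finset.monotone_filter_right _ fun z _ hz => lt_trans hz hxy
    · simpa using ⟨hx, hxy⟩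
    · simp
  have hsucc : ∀ x ∉ K, ∀ y, key y = key x + 1 → pos x + 1 = pos y := by
    intro x hx y hxy
    have h1 : (Kᶜ.filter fun z => key z < key y) = insert x (Kᶜ.filter fun z => key z < key x) := by
      ext z
      simp only [Finset.mem_filter, Finset.mem_compl, Finset.mem_insert]
      constructor
      · rintro ⟨hz, hlt⟩
        by_cases hzx : key z < key x
        · exact Or.inr ⟨hz, hzx⟩
        · exact Or.inl (hinj z hz x hx (by omega))
      · rintro (rfl | ⟨hz, hlt⟩)
        · exact ⟨hx, by omega⟩
        · exact ⟨hz, by omega⟩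
    change _ = (Kᶜ.filter fun z => key z < key y).card
    rw [h1, Finset.card_insert_of_notMem (by simp)]
  have hposa : pos a' = 0 := by
    rw [Finset.card_eq_zero, Finset.filter_eq_empty_iff]
    intro z hz
    exact not_lt.2 (hmin z (by simpa using hz)).1
  have hposb : pos b' + 1 = k := by
    have h1 : (Kᶜ.filter fun z => key z < key b') = Kᶜ.erase b' := by
      ext z
      simp only [Finset.mem_filter, Finset.mem_compl, Finset.mem_erase]
      constructor
      · rintro ⟨hz, hlt⟩
        exact ⟨fun h' => by simp [h'] at hlt, hz⟩
      · rintro ⟨hzb, hz⟩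
        refine ⟨hz, lt_of_le_of_ne (hmin z hz).2 fun h' => hzb (hinj z hz b' h.b'_notMem h')⟩
    change (Kᶜ.filter fun z => key z < key b').card + 1 = k
    rw [h1, Finset.card_erase_add_one (by simpa using h.b'_notMem), hcard]
  let f : V → Fin t ⊕ Fin k := fun y =>
    if hy : y ∈ K then .inl (e ⟨y, hy⟩) else .inr ⟨pos y, hlt y hy⟩
  have hf1 : ∀ y (hy : y ∈ K), f y = .inl (e ⟨y, hy⟩) := fun y hy => dif_pos hy
  have hf2 : ∀ y (hy : y ∉ K), f y = .inr ⟨pos y, hlt y hy⟩ := fun y hy => dif_neg hy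
  have hbij : Function.Bijective f := by
    rw [Fintype.bijective_iff_injective_and_card]
    refine ⟨?_, by simp [hV]⟩
    intro x y hxy
    by_cases hx : x ∈ K <;> by_cases hy : y ∈ K
    · rw [hf1 x hx, hf1 y hy] at hxy
      exact congrArg Subtype.val (e.injective (Sum.inl.inj hxy))
    · rw [hf1 x hx, hf2 y hy] at hxy
      exact absurd hxy (by simp)
    · rw [hf2 x hx, hf1 y hy] at hxy
      exact absurd hxy (by simp)
    · rw [hf2 x hx, hf2 y hy] at hxy
      have hpos : pos x = pos y := congrArg Fin.val (Sum.inr.inj hxy)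
      refine hinj x hx y hy ?_
      rcases lt_trichotomy (key x) (key y) with h' | h' | h'
      · have := hmono x hx y h'
        omega
      · exact h'
      · have := hmono y hy x h'
        omega
  have hout : ∀ x ∈ K, ∀ y ∉ K, G.Adj x y →
      (subdivideEdge (⊤ : SimpleGraph (Fin t)) i j k).Adj (f x) (f y) := by
    intro x hx y hy hxy
    rw [hf1 x hx, hf2 y hy]
    rcases (h.adj_out_iff x hx y hy).1 hxy with ⟨rfl, rfl⟩ | ⟨rfl, rfl⟩
    · exact Or.inl ⟨hea, hposa⟩
    · exact Or.inr ⟨heb, hposb⟩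
  refine ⟨Equiv.ofBijective f hbij, fun x y hxy => ?_⟩
  change (subdivideEdge (⊤ : SimpleGraph (Fin t)) i j k).Adj (f x) (f y)
  by_cases hx : x ∈ K <;> by_cases hy : y ∈ K
  · rw [hf1 x hx, hf1 y hy]
    obtain ⟨hne, hs⟩ := (h.adj_iff x hx y hy).1 hxy
    have hinj' : ∀ {u w : V} (hu : u ∈ K) (hw : w ∈ K), e ⟨u, hu⟩ = e ⟨w, hw⟩ → u = w :=
      fun hu hw h' => congrArg Subtype.val (e.injective h')
    refine ⟨fun h' => hne (hinj' hx hy h'), Or.inr fun h' => hs ?_⟩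
    rw [← hea, ← heb, Sym2.eq_iff] at h'
    rw [Sym2.eq_iff]
    exact h'.imp (fun h' => ⟨hinj' _ _ h'.1, hinj' _ _ h'.2⟩)
      fun h' => ⟨hinj' _ _ h'.1, hinj' _ _ h'.2⟩
  · exact hout x hx y hy hxy
  · exact (hout y hy x hx hxy.symm).symm
  · rw [hf2 x hx, hf2 y hy]
    rcases hadj x hx y hy hxy with h' | h'
    · exact Or.inr (hsucc y hy x h')
    · exact Or.inl (hsucc x hx y h')

end Outside

/-! ### The complete graph with one subdivided edge is `K_{1,t}`-minor free -/

section Ring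

variable {V : Type*} {G : SimpleGraph V}

/-- The vertices outside `I` lie at distinct positions `0, …, m`, adjacent ones one unit apart, and
only those at the positions `0` and `m` can have neighbours in `I`. -/
structure IsPathOutside (G : SimpleGraph V) (I : Finset V) (m : ℕ) (pos : V → ℕ) : Prop where
  le : ∀ x ∉ I, pos x ≤ m
  inj : ∀ x ∉ I, ∀ y ∉ I, pos x = pos y → x = y
  adj : ∀ x ∉ I, ∀ y ∉ I, G.Adj x y → pos x + 1 = pos y ∨ pos y + 1 = pos x
  adj_mem : ∀ x ∉ I, ∀ y ∈ I, G.Adj x y → pos x = 0 ∨ pos x = m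

variable {I : Finset V} {m : ℕ} {pos : V → ℕ} {S : Set V}

theorem IsPathOutside.reflect (h : IsPathOutside G I m pos) :
    IsPathOutside G I m (fun x => m - pos x) where
  le x _ := Nat.sub_le _ _
  inj x hx y hy hxy := h.inj x hx y hy (by have := h.le x hx; have := h.le y hy; omega)
  adj x hx y hy hxy := by
    have := h.le x hx
    have := h.le y hy
    have := h.adj x hx y hy hxy
    omega
  adj_mem x hx y hy hxy := by
    have := h.le x hx
    have := h.adj_mem x hx y hy hxy
    omega

/-- Two path vertices `y`, `z` that are not in the connected set `S` separate the elements of `S`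
between them from the others. -/
theorem IsPathOutside.false_of_between (h : IsPathOutside G I m pos) (hS : (G.induce S).Connected)
    {x y z w : V} (hy : y ∉ I) (hz : z ∉ I) (hyS : y ∉ S) (hzS : z ∉ S) (hx : x ∉ I) (hxS : x ∈ S)
    (h1 : pos y < pos x) (h2 : pos x < pos z) (hwS : w ∈ S)
    (hw : w ∈ I ∨ pos w < pos y ∨ pos z < pos w) : False := by
  obtain ⟨u, huS, v, hvS, hu, hv, huv⟩ := exists_adj_of_induce_connected hS
    (fun u => u ∉ I ∧ pos y < pos u ∧ pos u < pos z) hxS hwS ⟨hx, h1, h2⟩ (by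
      rintro ⟨h3, h4, h5⟩
      rcases hw with hw | hw | hw
      · exact h3 hw
      · omega
      · omega)
  have hzm := h.le z hz
  by_cases hvI : v ∈ I
  · have := h.adj_mem u hu.1 v hvI huv
    omega
  · have h3 := h.adj u hu.1 v hvI huv
    have h4 : pos v ≠ pos y := fun h' => hyS (h.inj v hvI y hy h' ▸ hvS)
    have h5 : pos v ≠ pos z := fun h' => hzS (h.inj v hvI z hz h' ▸ hvS)
    exact hv ⟨hvI, by omega, by omega⟩

/-- A connected set has at most one outside neighbour on the path that is entered in the increasing
direction; if the set meets `I`, then position `0` counts as such, too. -/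
theorem IsPathOutside.unique_entry (h : IsPathOutside G I m pos) (hS : (G.induce S).Connected)
    {y z : V} (hy : y ∉ I) (hz : z ∉ I) (hyS : y ∉ S) (hzS : z ∉ S)
    (hy' : (∃ x ∈ S, x ∉ I ∧ pos x + 1 = pos y) ∨ ((∃ u ∈ S, u ∈ I) ∧ pos y = 0))
    (hz' : (∃ x ∈ S, x ∉ I ∧ pos x + 1 = pos z) ∨ ((∃ u ∈ S, u ∈ I) ∧ pos z = 0)) : y = z := by
  by_contra hne
  wlog hlt : pos y < pos z generalizing y z
  · refine this hz hy hzS hyS hz' hy' (Ne.symm hne) (lt_of_le_of_ne (not_lt.1 hlt) fun h' => ?_)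
    exact hne (h.inj z hz y hy h').symm
  rcases hz' with ⟨x, hxS, hx, hxz⟩ | ⟨-, h0⟩
  · have hxy : pos x ≠ pos y := fun h' => hyS (h.inj x hx y hy h' ▸ hxS)
    rcases hy' with ⟨w, hwS, hw, hwy⟩ | ⟨⟨u, huS, hu⟩, -⟩
    · exact h.false_of_between hS hy hz hyS hzS hx hxS (by omega) (by omega) hwS
        (Or.inr (Or.inl (by omega)))
    · exact h.false_of_between hS hy hz hyS hzS hx hxS (by omega) (by omega) huS (Or.inl hu)
  · omega

/-- If a connected set avoids `I` and contains position `0`, it is an initial segment of the path,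
so it has no outside neighbour below it. -/
theorem IsPathOutside.no_entry_from_above (h : IsPathOutside G I m pos)
    (hS : (G.induce S).Connected) (hSI : ∀ u ∈ S, u ∉ I) {x y w : V} (hy : y ∉ I) (hyS : y ∉ S)
    (hxS : x ∈ S) (hxy : pos y < pos x) (hwS : w ∈ S) (hw : pos w = 0) : False := by
  obtain ⟨u, huS, v, hvS, hu, hv, huv⟩ := exists_adj_of_induce_connected hS
    (fun u => pos y < pos u) hxS hwS hxy (by omega)
  have h1 := h.adj u (hSI u huS) v (hSI v hvS) huv
  have h2 : pos v ≠ pos y := fun h' => hyS (h.inj v (hSI v hvS) y hy h' ▸ hvS)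
  omega

theorem IsPathOutside.starMinorFree (h : IsPathOutside G I m pos) {t : ℕ} (ht : 3 ≤ t)
    (hI : I.card + 2 = t) : StarMinorFree t G := by
  classical
  refine starMinorFree_iff.2 fun S hS T hT => ?_
  have hsplit := Finset.card_filter_add_card_filter_not (s := T) (fun y => y ∈ I)
  have hr := h.reflect
  have hrefl : ∀ {x y}, x ∉ I → y ∉ I → pos y + 1 = pos x → m - pos x + 1 = m - pos y := by
    intro x y hx hy hxy
    have := h.le x hx
    omega
  by_cases hSI : ∃ u ∈ S, u ∈ I
  · obtain ⟨u, huS, hu⟩ := hSI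
    have h1 : (T.filter fun y => y ∈ I).card + 1 ≤ I.card := by
      rw [← Finset.card_erase_add_one hu]
      refine Nat.succ_le_succ (Finset.card_le_card fun y hy => ?_)
      obtain ⟨hyT, hyI⟩ := Finset.mem_filter.1 hy
      exact Finset.mem_erase.2 ⟨fun h' => (hT y hyT).1 (h' ▸ huS), hyI⟩
    let L := T.filter fun y => y ∉ I ∧ ((∃ x ∈ S, x ∉ I ∧ pos x + 1 = pos y) ∨ pos y = 0)
    let R := T.filter fun y => y ∉ I ∧
      ((∃ x ∈ S, x ∉ I ∧ m - pos x + 1 = m - pos y) ∨ m - pos y = 0)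
    have hL : L.card ≤ 1 := Finset.card_le_one.2 fun y hy z hz => by
      obtain ⟨hyT, hyI, hy'⟩ := Finset.mem_filter.1 hy
      obtain ⟨hzT, hzI, hz'⟩ := Finset.mem_filter.1 hz
      exact h.unique_entry hS hyI hzI (hT y hyT).1 (hT z hzT).1
        (hy'.imp_right fun h' => ⟨⟨u, huS, hu⟩, h'⟩) (hz'.imp_right fun h' => ⟨⟨u, huS, hu⟩, h'⟩)
    have hR : R.card ≤ 1 := Finset.card_le_one.2 fun y hy z hz => by
      obtain ⟨hyT, hyI, hy'⟩ := Finset.mem_filter.1 hy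
      obtain ⟨hzT, hzI, hz'⟩ := Finset.mem_filter.1 hz
      exact hr.unique_entry hS hyI hzI (hT y hyT).1 (hT z hzT).1
        (hy'.imp_right fun h' => ⟨⟨u, huS, hu⟩, h'⟩) (hz'.imp_right fun h' => ⟨⟨u, huS, hu⟩, h'⟩)
    have hsub : (T.filter fun y => y ∉ I) ⊆ L ∪ R := by
      intro y hy
      obtain ⟨hyT, hyI⟩ := Finset.mem_filter.1 hy
      obtain ⟨-, x, hxS, hxy⟩ := hT y hyT
      rw [Finset.mem_union]
      by_cases hx : x ∈ I
      · rcases h.adj_mem y hyI x hx hxy.symm with h0 | h0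
        · exact Or.inl (Finset.mem_filter.2 ⟨hyT, hyI, Or.inr h0⟩)
        · exact Or.inr (Finset.mem_filter.2 ⟨hyT, hyI, Or.inr (by omega)⟩)
      · rcases h.adj x hx y hyI hxy with h0 | h0
        · exact Or.inl (Finset.mem_filter.2 ⟨hyT, hyI, Or.inl ⟨x, hxS, hx, h0⟩⟩)
        · exact Or.inr (Finset.mem_filter.2 ⟨hyT, hyI, Or.inl ⟨x, hxS, hx, hrefl hx hyI h0⟩⟩)
    have h2 := (Finset.card_le_card hsub).trans (Finset.card_union_le L R)
    omega
  · have hSI' : ∀ u ∈ S, u ∉ I := fun u hu hu' => hSI ⟨u, hu, hu'⟩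
    have h1 : (T.filter fun y => y ∈ I).card ≤ I.card :=
      Finset.card_le_card fun y hy => (Finset.mem_filter.1 hy).2
    let L := T.filter fun y => y ∉ I ∧ ∃ x ∈ S, x ∉ I ∧ pos x + 1 = pos y
    let R := T.filter fun y => y ∉ I ∧ ∃ x ∈ S, x ∉ I ∧ m - pos x + 1 = m - pos y
    have hL : L.card ≤ 1 := Finset.card_le_one.2 fun y hy z hz => by
      obtain ⟨hyT, hyI, hy'⟩ := Finset.mem_filter.1 hy
      obtain ⟨hzT, hzI, hz'⟩ := Finset.mem_filter.1 hz
      exact h.unique_entry hS hyI hzI (hT y hyT).1 (hT z hzT).1 (Or.inl hy') (Or.inl hz')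
    have hR : R.card ≤ 1 := Finset.card_le_one.2 fun y hy z hz => by
      obtain ⟨hyT, hyI, hy'⟩ := Finset.mem_filter.1 hy
      obtain ⟨hzT, hzI, hz'⟩ := Finset.mem_filter.1 hz
      exact hr.unique_entry hS hyI hzI (hT y hyT).1 (hT z hzT).1 (Or.inl hy') (Or.inl hz')
    have hsub : (T.filter fun y => y ∉ I) ⊆ L ∪ R := by
      intro y hy
      obtain ⟨hyT, hyI⟩ := Finset.mem_filter.1 hy
      obtain ⟨-, x, hxS, hxy⟩ := hT y hyT
      have hx := hSI' x hxS
      rw [Finset.mem_union]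
      rcases h.adj x hx y hyI hxy with h0 | h0
      · exact Or.inl (Finset.mem_filter.2 ⟨hyT, hyI, ⟨x, hxS, hx, h0⟩⟩)
      · exact Or.inr (Finset.mem_filter.2 ⟨hyT, hyI, ⟨x, hxS, hx, hrefl hx hyI h0⟩⟩)
    have h2 := (Finset.card_le_card hsub).trans (Finset.card_union_le L R)
    rcases (T.filter fun y => y ∈ I).eq_empty_or_nonempty with h3 | ⟨y, hy⟩
    · rw [h3, Finset.card_empty] at hsplit
      omega
    · -- an outside neighbour in `I` puts an end of the path into `S`
      obtain ⟨hyT, hyI⟩ := Finset.mem_filter.1 hy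
      obtain ⟨-, w, hwS, hwy⟩ := hT y hyT
      rcases h.adj_mem w (hSI' w hwS) y hyI hwy with h0 | h0
      · have hR0 : R = ∅ := Finset.filter_eq_empty_iff.2 fun z hzT ⟨hzI, x, hxS, hx, hxz⟩ =>
          h.no_entry_from_above hS hSI' hzI (hT z hzT).1 hxS (by omega) hwS h0
        rw [hR0, Finset.card_empty] at h2
        omega
      · have hL0 : L = ∅ := Finset.filter_eq_empty_iff.2 fun z hzT ⟨hzI, x, hxS, hx, hxz⟩ =>
          hr.no_entry_from_above hS hSI' hzI (hT z hzT).1 hxS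
            (by have := h.le z hzI; omega) hwS (by omega)
        rw [hL0, Finset.card_empty] at h2
        omega

end Ring

section Subdivide

variable {t k : ℕ} {i j : Fin t}

theorem subdivideEdge_starMinorFree (ht : 3 ≤ t) (hij : i ≠ j) (hk : 0 < k) :
    StarMinorFree t (subdivideEdge (⊤ : SimpleGraph (Fin t)) i j k) := by
  let I : Finset (Fin t ⊕ Fin k) := ((Finset.univ.erase i).erase j).map Function.Embedding.inl
  let pos : Fin t ⊕ Fin k → ℕ := Sum.elim (fun x => if x = i then 0 else k + 1) (fun l => l.val + 1)
  have hpi : pos (.inl i) = 0 := if_pos rfl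
  have hpj : pos (.inl j) = k + 1 := if_neg hij.symm
  have hpl : ∀ l : Fin k, pos (.inr l) = l.val + 1 := fun _ => rfl
  have hmem : ∀ x : Fin t, .inl x ∈ I ↔ x ≠ j ∧ x ≠ i := by simp [I]
  have hcases : ∀ x, x ∉ I → x = .inl i ∨ x = .inl j ∨ ∃ l, x = .inr l := by
    rintro (x | l) hx
    · rw [hmem] at hx
      by_cases h1 : x = i
      · exact Or.inl (congrArg _ h1)
      by_cases h2 : x = j
      · exact Or.inr (Or.inl (congrArg _ h2))
      exact absurd ⟨h2, h1⟩ hx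
    · exact Or.inr (Or.inr ⟨l, rfl⟩)
  have hcard : I.card + 2 = t := by
    have h1 := Finset.card_erase_add_one (Finset.mem_univ i)
    have h2 := Finset.card_erase_add_one (Finset.mem_erase.2 ⟨hij.symm, Finset.mem_univ j⟩)
    rw [Finset.card_univ, Fintype.card_fin] at h1
    rw [Finset.card_map]
    omega
  clear_value pos
  refine IsPathOutside.starMinorFree (I := I) (m := k + 1) (pos := pos) ⟨?_, ?_, ?_, ?_⟩ ht hcard
  · intro x hx
    rcases hcases x hx with rfl | rfl | ⟨l, rfl⟩
    · omega
    · omega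
    · have := hpl l
      omega
  · intro x hx y hy hxy
    rcases hcases x hx with rfl | rfl | ⟨l, rfl⟩ <;>
    rcases hcases y hy with rfl | rfl | ⟨l', rfl⟩ <;>
    simp only [hpi, hpj, hpl] at hxy
    · rfl
    · omega
    · omega
    · omega
    · rfl
    · omega
    · omega
    · omega
    · rw [Fin.ext (Nat.succ.inj hxy)]
  · intro x hx y hy hxy
    rcases hcases x hx with rfl | rfl | ⟨l, rfl⟩ <;>
    rcases hcases y hy with rfl | rfl | ⟨l', rfl⟩ <;>
    simp only [hpi, hpj, hpl]
    · exact absurd rfl hxy.1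
    · exact absurd rfl (hxy.2.resolve_left hk.ne')
    · rcases hxy with h | h
      · omega
      · exact absurd h.1 hij
    · exact absurd Sym2.eq_swap (hxy.2.resolve_left hk.ne')
    · exact absurd rfl hxy.1
    · rcases hxy with h | h
      · exact absurd h.1.symm hij
      · omega
    · rcases hxy with h | h
      · omega
      · exact absurd h.1 hij
    · rcases hxy with h | h
      · exact absurd h.1.symm hij
      · omega
    · rcases hxy with h | h
      · omega
      · omega
  · intro x hx y hy hxy
    rcases hcases x hx with rfl | rfl | ⟨l, rfl⟩
    · exact Or.inl hpi
    · exact Or.inr hpj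
    · rcases y with y | l'
      · rw [hmem] at hy
        rcases hxy with h | h
        · exact absurd h.1 hy.2
        · exact absurd h.1 hy.1
      · simp [I] at hy

theorem subdivideEdge_isCore (hij : i ≠ j) (hk : 2 ≤ k) :
    IsCore (subdivideEdge (⊤ : SimpleGraph (Fin t)) i j k)
      (Finset.univ.map Function.Embedding.inl) (.inl i) (.inl j) (.inr ⟨0, by omega⟩)
      (.inr ⟨k - 1, by omega⟩) where
  a_mem := by simp
  b_mem := by simp
  ne := by simpa using hij
  a'_notMem := by simp
  b'_notMem := by simp
  ne' := by
    rw [Ne, Sum.inr.injEq, Fin.ext_iff]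
    simp only
    omega
  adj_iff := by
    rintro (x | l) hx (y | l') hy
    · have h : s((.inl x : Fin t ⊕ Fin k), .inl y) = s(.inl i, .inl j) ↔ s(x, y) = s(i, j) := by
        simp only [Sym2.eq_iff, Sum.inl.injEq]
      rw [Ne, Ne, h, Sum.inl.injEq]
      exact and_congr Iff.rfl (or_iff_right (by omega))
    · simp at hy
    · simp at hx
    · simp at hx
  adj_out_iff := by
    rintro (x | l) hx (y | l') hy
    · simp at hy
    · simp only [Sum.inl.injEq, Sum.inr.injEq]
      refine or_congr (and_congr Iff.rfl (by rw [Fin.ext_iff])) (and_congr Iff.rfl ?_)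
      rw [Fin.ext_iff]
      simp only
      omega
    · simp at hx
    · simp at hx

theorem subdivideEdge_connected (ht : 3 ≤ t) (hij : i ≠ j) :
    (subdivideEdge (⊤ : SimpleGraph (Fin t)) i j k).Connected := by
  obtain ⟨c, hc⟩ : ∃ c, c ∉ ({i, j} : Finset (Fin t)) := by
    by_contra! hcon
    have h1 := Finset.card_pair hij
    rw [Finset.eq_univ_iff_forall.2 hcon, Finset.card_univ, Fintype.card_fin] at h1
    omega
  rw [Finset.mem_insert, Finset.mem_singleton, not_or] at hc
  have hcore : ∀ x : Fin t, (subdivideEdge (⊤ : SimpleGraph (Fin t)) i j k).Reachable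
      (.inl x) (.inl c) := by
    intro x
    by_cases hx : x = c
    · rw [hx]
    · refine Adj.reachable ⟨hx, Or.inr ?_⟩
      rw [Ne, Sym2.eq_iff]
      tauto
  have hpath : ∀ l (hl : l < k), (subdivideEdge (⊤ : SimpleGraph (Fin t)) i j k).Reachable
      (.inr ⟨l, hl⟩) (.inl c) := by
    intro l
    induction l with
    | zero =>
      intro hl
      have h : (subdivideEdge (⊤ : SimpleGraph (Fin t)) i j k).Adj (.inr ⟨0, hl⟩) (.inl i) :=
        Or.inl ⟨rfl, rfl⟩
      exact h.reachable.trans (hcore i)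
    | succ l ih =>
      intro hl
      have h : (subdivideEdge (⊤ : SimpleGraph (Fin t)) i j k).Adj (.inr ⟨l + 1, hl⟩)
          (.inr ⟨l, by omega⟩) := Or.inr rfl
      exact h.reachable.trans (ih _)
  have hall : ∀ x, (subdivideEdge (⊤ : SimpleGraph (Fin t)) i j k).Reachable x (.inl c) := by
    rintro (x | ⟨l, hl⟩)
    · exact hcore x
    · exact hpath l hl
  have : Nonempty (Fin t ⊕ Fin k) := ⟨.inl c⟩
  exact ⟨fun x y => (hall x).trans (hall y).symm⟩

/-! ### Order at least `t + 2` -/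

theorem isExtremal_iff_of_add_two_le {n : ℕ} (ht : 3 ≤ t) (hn : t + 2 ≤ n) (hij : i ≠ j)
    (G : SimpleGraph (Fin n)) :
    IsExtremal t G ↔
      Nonempty (G ≃g subdivideEdge (⊤ : SimpleGraph (Fin t)) i j (n - t)) := by
  have hconn := subdivideEdge_connected (k := n - t) ht hij
  refine isExtremal_iff (by simp only [Fintype.card_sum, Fintype.card_fin]; omega) hconn
    (subdivideEdge_starMinorFree ht hij (by omega)) ?_ G
  intro G' h1 h2 hq
  have hcast : ((t - 1 : ℕ) : ℝ) = t - 1 := by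
    rw [Nat.cast_sub (by omega)]
    simp
  have ht' : (3 : ℝ) ≤ t := by exact_mod_cast ht
  set H := subdivideEdge (⊤ : SimpleGraph (Fin t)) i j (n - t)
  obtain ⟨δ', hδ'⟩ : ∃ δ', qIndex H = 2 * ((t : ℝ) - 1) - δ' :=
    ⟨2 * ((t : ℝ) - 1) - qIndex H, by ring⟩
  obtain ⟨δ, hδ⟩ : ∃ δ, qIndex G' = 2 * ((t : ℝ) - 1) - δ :=
    ⟨2 * ((t : ℝ) - 1) - qIndex G', by ring⟩
  have hle : δ ≤ δ' := by linarith
  obtain ⟨hδ2', hδt'⟩ := (subdivideEdge_isCore hij (by omega)).qIndex_bound hconn ht (by simp) hδ'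
  have hδ2 : δ < 2 := by linarith
  have hδt : (t + 1) * δ - δ ^ 2 < 2 := by
    have := mul_nonneg (sub_nonneg.2 hle) (show 0 ≤ (t : ℝ) + 1 - δ - δ' by linarith)
    linarith
  obtain ⟨v, hv, hN⟩ := exists_degree_eq_of_qIndex_eq h1 (D := t - 1) (δ := δ)
    (fun v => by have := h2.degree_lt v; omega) (by rw [hcast, hδ]) hδ2
    (by rw [hcast]; linarith)
  obtain ⟨K, hK, a, b, a', b', hcore⟩ :=
    exists_isCore h1 ht (by rwa [Fintype.card_fin]) h2 hv hN
  obtain ⟨φ, hφ⟩ := hcore.exists_equiv h1 hK h2 (k := n - t)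
    (by rw [Fintype.card_fin]; omega) hij
  exact nonempty_iso_of_qIndex_le h1 φ hφ hq

end Subdivide

end QIndexMinor

theorem theorem1p1 (t n : ℕ) (ht : 3 ≤ t) (hn : t + 1 ≤ n) (G : SimpleGraph (Fin n)) :
    (n = t + 1 → Even n →
      (QIndexMinor.IsExtremal t G ↔
        Nonempty (G ≃g (⊤ : SimpleGraph (Fin n)).deleteEdges (QIndexMinor.pairing n)))) ∧
    (n = t + 1 → Odd n →
      (QIndexMinor.IsExtremal t G ↔
        Nonempty (G ≃g (⊤ : SimpleGraph (Fin n)).deleteEdges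
          (QIndexMinor.pairing n ∪
            {s((⟨n - 2, by omega⟩ : Fin n), (⟨n - 1, by omega⟩ : Fin n))})))) ∧
    (t + 2 ≤ n →
      (QIndexMinor.IsExtremal t G ↔
        Nonempty (G ≃g QIndexMinor.subdivideEdge (⊤ : SimpleGraph (Fin t))
          ⟨0, by omega⟩ ⟨1, by omega⟩ (n - t)))) :=
  ⟨fun h he => QIndexMinor.isExtremal_iff_of_even ht h he G,
    fun h ho => QIndexMinor.isExtremal_iff_of_odd ht h ho G,
    fun h => QIndexMinor.isExtremal_iff_of_add_two_le ht h (by simp [Fin.ext_iff]) G⟩
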